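/- **Setting.** Let a binary convolutional encoder have $k_c$ input bits and $n_c$ output bits per branch and memory order $m$. A block of $H\ge 1$ information blocks (of $k_c$ bits each) is followed by $m$ zero blocks and encoded. A *detour* is a trellis path that leaves the all-zero path and merges with it again for the first time at its end. The transfer function is $T(D,N)=\sum D^{\mathrm{wt}}N^{\mathrm{info}}$, summed over all detours, where $\mathrm{wt}$ is the Hamming weight of the output and $\mathrm{info}$ the number of ones in the input; it is assumed to exist, i.e. there are finitely many detours of each weight. Write $T(D,1)=\sum_k a_kD^k$ and $\frac{\partial T}{\partial N}(D,1)=\sum_k c_kD^k$. Let $d_f$, the free distance, be the smallest weight of a detour, and assume $d_f>0$. The code bits are mapped to $x_{ij}=\pm1$ ($1\le i\le n_c$, $1\le j\le H+m$) and the receiver observes $y_{ij}=\sqrt{E_c}\,\alpha_{ij}x_{ij}+n_{ij}$ and the $\alpha_{ij}$, where all $\alpha_{ij}$ and $n_{ij}$ are independent, $n_{ij}\sim\mathcal N(0,N_0/2)$, and $\alpha_{ij}$ is Rician with density $\frac{r}{\sigma^2}e^{-(r^2+s^2)/(2\sigma^2)}I_0(rs/\sigma^2)$, $r\ge0$ ($E_c,N_0,\sigma>0$,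 $s\ge0$). **Decoder (Yamamoto–Itoh, flag $u\ge0$).** Start at level $0$ with label $\mathcal C$. At each node of each level $t\le H+m$ the decoder extends the survivors of level $t-1$, and keeps the entering path $x$ with the largest metric $\sum_{j\le t}\sum_i\alpha_{ij}x_{ij}y_{ij}$ (ties broken arbitrarily). The survivor is labelled $\mathcal C$ if it was labelled $\mathcal C$ at level $t-1$ and, for each other path $x'$ entering the node (for $k_c=1$ there is at most one, the one with the second largest metric), $$\sum_{j\le t}\sum_i\alpha_{ij}(x_{ij}-x'_{ij})y_{ij}\ \ge\ \frac{u}{d_f}\sqrt{N_0/2}\,\sum_{j\le t}\sum_i|x'_{ij}-x_{ij}|\,\alpha_{ij}^2 ;$$ otherwise it is labelled $\mathcal X$. Retransmission of the frame is requested if the survivor at level $H+m$ is labelled $\mathcal X$. **Performance measures**, for any transmitted information sequence and any branch (from level $t-1$ to level $t$, $1\le t\le H+m$), averaged over fading and noise: - $P_e(u)$, the first-event error probability per branch: the probability that the transmitted path is the survivor at its node of level $t-1$ and is eliminated at its node of level $t$ by a path that survives with label $\mathcal C$; - $P_b(u)$: the expected number of wrong information bits on the path that causes this first-event error (zero if there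 is no such error); - $P_x(u)$: the probability that the transmitted path is the survivor with label $\mathcal C$ at its node of level $t-1$ and the survivor at its node of level $t$ is labelled $\mathcal X$. **Proposition.** For every transmitted information sequence and every branch, $$P_e(u)\le\sum_{k=d_f}^{n_c(H+m)}a_k\,\tilde D(E_c/N_0,u/d_f,\sigma,s)^k,\qquad P_b(u)\le\sum_{k=d_f}^{n_c(H+m)}c_k\,\tilde D(E_c/N_0,u/d_f,\sigma,s)^k,$$ and, if $u<d_f\sqrt{2E_c/N_0}$, $$P_x(u)\le\sum_{k=d_f}^{n_c(H+m)}a_k\,\tilde D(E_c/N_0,-u/d_f,\sigma,s)^k,$$ and the probability that retransmission of the frame is requested is at most $H$ times this last sum. Here, with $\gamma=s^2/(2\sigma^2)$ and $Q(x)=\frac1{\sqrt{2\pi}}\int_x^\infty e^{-t^2/2}\,dt$, $$\tilde D(\rho,v,\sigma,s)=\frac{e^{-\gamma}}{\pi}\int_0^\pi\Lambda(\theta)\,d\theta,\qquad \Lambda(\theta)=\frac1{2A\sigma^2}\Big[1-\frac{B_\theta\sqrt{2\pi}}{\sqrt{2A}}\,e^{B_\theta^2/(4A)}\,Q\Big(\frac{B_\theta}{\sqrt{2A}}\Big)\Big],$$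 $$A=\tfrac12\big(\sqrt{2\rho}+v\big)^2+\frac1{2\sigma^2},\qquad B_\theta=-\frac{s\cos\theta}{\sigma^2}.$$ -/

import Mathlib

open MeasureTheory ProbabilityTheory

/-- A binary convolutional encoder with `kc` input bits and `nc` output bits per branch and memory
order (at most) `m`; `gen l` is the coefficient of `Z ^ l` in the generator polynomial matrix. -/
structure ConvCode where
  kc : ℕ
  nc : ℕ
  m : ℕ
  gen : Fin (m + 1) → Matrix (Fin kc) (Fin nc) (ZMod 2)

namespace ConvCode

/-- The information bits entering the encoder on one branch. -/
abbrev Block (C : ConvCode) : Type := Fin C.kc → ZMod 2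

/-- A trellis state (node): the last `m` input blocks, the most recent one first. -/
abbrev State (C : ConvCode) : Type := Fin C.m → C.Block

/-- A trellis branch: the content of the register, i.e. the current input block followed by the
last `m` ones. -/
abbrev Branch (C : ConvCode) : Type := Fin (C.m + 1) → C.Block

/-- An input sequence, which is also a path in the trellis that starts in the zero state at
level `0`. A path of `t` branches is given by the blocks with index `< t`. -/
abbrev Input (C : ConvCode) : Type := ℕ → C.Block

/-- The node from which a branch leaves. -/
def source (C : ConvCode) (e : C.Branch) : C.State := fun l => e l.succ

/-- The node which a branch enters. -/
def target (C : ConvCode) (e : C.Branch) : C.State := fun l => e l.castSucc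

/-- The branch from level `j` to level `j + 1` of a path. -/
def branch (C : ConvCode) (p : C.Input) (j : ℕ) : C.Branch :=
  fun l => if (l : ℕ) ≤ j then p (j - l) else 0

/-- The node of a path at level `t`. -/
def state (C : ConvCode) (p : C.Input) (t : ℕ) : C.State :=
  fun l => if (l : ℕ) < t then p (t - 1 - l) else 0

/-- The `i`-th output bit of a branch. -/
def output (C : ConvCode) (e : C.Branch) (i : Fin C.nc) : ZMod 2 :=
  ∑ l, ∑ b, e l b * C.gen l b i

/-- The `i`-th code bit on the `j`-th branch of a path. -/
def codeBit (C : ConvCode) (p : C.Input) (j : ℕ) (i : Fin C.nc) : ZMod 2 :=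
  C.output (C.branch p j) i

/-- Antipodal modulation of the code bits of a path. -/
noncomputable def symbol (C : ConvCode) (p : C.Input) (j : ℕ) (i : Fin C.nc) : ℝ :=
  if C.codeBit p j i = 0 then 1 else -1

/-! ### Transfer function -/

/-- `p` leaves the all-zero path at level `0` and merges with it again for the first time at
level `L`. For `m = 0` the node is always zero, and such a path is one nonzero branch. -/
structure IsDetour (C : ConvCode) (L : ℕ) (p : C.Input) : Prop where
  pos : 0 < L
  leaves : p 0 ≠ 0
  unmerged : ∀ t, 0 < t → t < L → C.state p t ≠ 0
  merges : C.state p L = 0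
  after : ∀ j, L ≤ j → p j = 0

/-- The Hamming weight of the first `L` branches of a path. -/
def weight (C : ConvCode) (L : ℕ) (p : C.Input) : ℕ :=
  ∑ j ∈ Finset.range L, (Finset.univ.filter fun i => C.codeBit p j i ≠ 0).card

/-- The number of ones among the first `L` input blocks. -/
def infoWeight (C : ConvCode) (L : ℕ) (p : C.Input) : ℕ :=
  ∑ j ∈ Finset.range L, (Finset.univ.filter fun b => p j b ≠ 0).card

/-- The detours (with their lengths) of Hamming weight `k`. -/
def detours (C : ConvCode) (k : ℕ) : Set (ℕ × C.Input) :=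
  {d | C.IsDetour d.1 d.2 ∧ C.weight d.1 d.2 = k}

/-- The transfer function exists as a power series in `D` with coefficients polynomial in `N`. -/
def HasTransferFunction (C : ConvCode) : Prop := ∀ k, (C.detours k).Finite

/-- The transfer function `T(D, N)`, a power series in `D` with coefficients in `ℕ[N]`: each
detour contributes `D ^ (Hamming weight) * N ^ (number of information ones)`. -/
noncomputable def transferFunction (C : ConvCode) : PowerSeries (Polynomial ℕ) :=
  PowerSeries.mk fun k => ∑ᶠ d ∈ C.detours k, Polynomial.X ^ C.infoWeight d.1 d.2

/-- The coefficient of `D ^ k` in `T(D, 1)`. -/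
noncomputable def a (C : ConvCode) (k : ℕ) : ℕ :=
  (PowerSeries.coeff k C.transferFunction).eval 1

/-- The coefficient of `D ^ k` in `dT(D, N)/dN` at `N = 1`. -/
noncomputable def c (C : ConvCode) (k : ℕ) : ℕ :=
  (Polynomial.derivative (PowerSeries.coeff k C.transferFunction)).eval 1

/-- The free distance `d_f`. -/
noncomputable def freeDist (C : ConvCode) : ℕ :=
  sInf {k | (C.detours k).Nonempty}

end ConvCode

/-- Labels of the survivors. -/
inductive FlagLabel
  | C
  | X

namespace ConvCode

/-! ### Yamamoto-Itoh decoding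

`H` is the number of information blocks, followed by `m` zero blocks; `f` are the fading envelopes
and `y` the received samples; `κ` is the factor `(u / d_f) * √(N₀ / 2)` in the test. -/

section Decoder

/-- The sum of the branch metrics over the first `t` branches of a path. -/
noncomputable def metric (C : ConvCode) (H : ℕ) (f y : Fin (H + C.m) → Fin C.nc → ℝ)
    (t : ℕ) (p : C.Input) : ℝ :=
  ∑ j : Fin (H + C.m) with j.val < t, ∑ i, f j i * C.symbol p j i * y j i

/-- The test of a path `p` against a competitor `p'` at level `t`. -/
def PassesTest (C : ConvCode) (H : ℕ) (κ : ℝ) (f y : Fin (H + C.m) → Fin C.nc → ℝ)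
    (t : ℕ) (p p' : C.Input) : Prop :=
  κ * ∑ j : Fin (H + C.m) with j.val < t, ∑ i, |C.symbol p' j i - C.symbol p j i| * f j i ^ 2
    ≤ ∑ j : Fin (H + C.m) with j.val < t, ∑ i, f j i * (C.symbol p j i - C.symbol p' j i) * y j i

/-- The branches from level `t` to level `t + 1` of the terminated trellis: blocks before the
start, and blocks of the tail, are zero. -/
def Admissible (C : ConvCode) (H t : ℕ) (e : C.Branch) : Prop :=
  ∀ l : Fin (C.m + 1), (t < (l : ℕ) ∨ H + l ≤ t) → e l = 0

open Classical in
/-- The branches of the terminated trellis that enter the node `S` at level `t + 1`. -/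
noncomputable def entering (C : ConvCode) (H t : ℕ) (S : C.State) : Finset C.Branch :=
  Finset.univ.filter fun e => C.Admissible H t e ∧ C.target e = S

open Classical in
/-- The survivor, with its label, at each node of level `t`. Among the survivors extended to
the node the one with the largest metric is kept (`pick` breaks ties). It is labelled `C` if it was
labelled `C` before and passes the test against each of the other paths that enter the node. (If
`kc = 1` there is at most one other, the path with the second largest metric; at levels up to `m`
there is none.) The value at a node which is not in the terminated trellis is irrelevant. -/
noncomputable def survivor (C : ConvCode) (H : ℕ) (κ : ℝ)
    (pick : Finset C.Branch → C.Branch) (f y : Fin (H + C.m) → Fin C.nc → ℝ) :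
    ℕ → C.State → C.Input × FlagLabel
  | 0, _ => (fun _ => 0, FlagLabel.C)
  | t + 1, S =>
    let path : C.Branch → C.Input := fun e =>
      Function.update (survivor C H κ pick f y t (C.source e)).1 t (e 0)
    let best : C.Branch := pick ((C.entering H t S).filter fun e =>
      ∀ e' ∈ C.entering H t S, C.metric H f y (t + 1) (path e') ≤ C.metric H f y (t + 1) (path e))
    (path best,
      if (survivor C H κ pick f y t (C.source best)).2 = FlagLabel.C ∧
          ∀ e' ∈ C.entering H t S, e' ≠ best →
            C.PassesTest H κ f y (t + 1) (path best) (path e')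
      then FlagLabel.C else FlagLabel.X)

/-- The transmitted path `w` is the survivor at its own node of level `t`. -/
def Survives (C : ConvCode) (H : ℕ) (κ : ℝ) (pick : Finset C.Branch → C.Branch)
    (f y : Fin (H + C.m) → Fin C.nc → ℝ) (w : C.Input) (t : ℕ) : Prop :=
  ∀ j < t, (C.survivor H κ pick f y t (C.state w t)).1 j = w j

/-- First-event error on branch `t`: the transmitted path, which has survived up to level `t`, is
eliminated at its node of level `t + 1` by a path that survives with label `C`. -/
def FirstEventError (C : ConvCode) (H : ℕ) (κ : ℝ) (pick : Finset C.Branch → C.Branch)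
    (f y : Fin (H + C.m) → Fin C.nc → ℝ) (w : C.Input) (t : ℕ) : Prop :=
  C.Survives H κ pick f y w t ∧ ¬ C.Survives H κ pick f y w (t + 1) ∧
    (C.survivor H κ pick f y (t + 1) (C.state w (t + 1))).2 = FlagLabel.C

/-- Retransmission event on branch `t`: the transmitted path has survived with label `C` up to
level `t`, and the survivor at its node of level `t + 1` is labelled `X`. -/
def RetransmissionEvent (C : ConvCode) (H : ℕ) (κ : ℝ) (pick : Finset C.Branch → C.Branch)
    (f y : Fin (H + C.m) → Fin C.nc → ℝ) (w : C.Input) (t : ℕ) : Prop :=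
  C.Survives H κ pick f y w t ∧
    (C.survivor H κ pick f y t (C.state w t)).2 = FlagLabel.C ∧
    (C.survivor H κ pick f y (t + 1) (C.state w (t + 1))).2 = FlagLabel.X

/-- Retransmission of the frame is requested: the survivor at the only node of the last level is
labelled `X`. -/
def FrameRetransmission (C : ConvCode) (H : ℕ) (κ : ℝ) (pick : Finset C.Branch → C.Branch)
    (f y : Fin (H + C.m) → Fin C.nc → ℝ) : Prop :=
  (C.survivor H κ pick f y (H + C.m) 0).2 = FlagLabel.X

open Classical in
/-- The number of wrong information bits on the path that causes a first-event error on branch `t`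
(zero if there is no such error). -/
noncomputable def bitErrors (C : ConvCode) (H : ℕ) (κ : ℝ) (pick : Finset C.Branch → C.Branch)
    (f y : Fin (H + C.m) → Fin C.nc → ℝ) (w : C.Input) (t : ℕ) : ℕ :=
  if C.FirstEventError H κ pick f y w t then
    ∑ j ∈ Finset.range (t + 1), (Finset.univ.filter fun b =>
      (C.survivor H κ pick f y (t + 1) (C.state w (t + 1))).1 j b ≠ w j b).card
  else 0

end Decoder

/-! ### Performance measures over the fading channel -/

section Performance

/-- The threshold factor in the test for the flag `u`. -/
noncomputable def threshold (C : ConvCode) (N₀ u : ℝ) : ℝ := u / C.freeDist * √(N₀ / 2)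

/-- The received samples when the input sequence `w` is transmitted. -/
noncomputable def received (C : ConvCode) (H : ℕ) (Ec : ℝ) (w : C.Input)
    (f z : Fin (H + C.m) → Fin C.nc → ℝ) : Fin (H + C.m) → Fin C.nc → ℝ :=
  fun j i => √Ec * f j i * C.symbol w j i + z j i

variable {Ω : Type*} [MeasurableSpace Ω]

/-- `P_e(u)`: the probability of a first-event error on branch `t`, when `w` is transmitted. -/
noncomputable def Pe (C : ConvCode) (H : ℕ) (Ec N₀ u : ℝ) (pick : Finset C.Branch → C.Branch)
    (P : Measure Ω) (α n : Fin (H + C.m) → Fin C.nc → Ω → ℝ) (w : C.Input) (t : ℕ) : ℝ :=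
  P.real {ω | C.FirstEventError H (C.threshold N₀ u) pick (fun j i => α j i ω)
    (C.received H Ec w (fun j i => α j i ω) (fun j i => n j i ω)) w t}

/-- `P_x(u)`: the probability of a retransmission event on branch `t`, when `w` is transmitted. -/
noncomputable def Px (C : ConvCode) (H : ℕ) (Ec N₀ u : ℝ) (pick : Finset C.Branch → C.Branch)
    (P : Measure Ω) (α n : Fin (H + C.m) → Fin C.nc → Ω → ℝ) (w : C.Input) (t : ℕ) : ℝ :=
  P.real {ω | C.RetransmissionEvent H (C.threshold N₀ u) pick (fun j i => α j i ω)
    (C.received H Ec w (fun j i => α j i ω) (fun j i => n j i ω)) w t}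

/-- The probability that retransmission of the whole frame is requested, when `w` is
transmitted. -/
noncomputable def PxFrame (C : ConvCode) (H : ℕ) (Ec N₀ u : ℝ)
    (pick : Finset C.Branch → C.Branch) (P : Measure Ω)
    (α n : Fin (H + C.m) → Fin C.nc → Ω → ℝ) (w : C.Input) : ℝ :=
  P.real {ω | C.FrameRetransmission H (C.threshold N₀ u) pick (fun j i => α j i ω)
    (C.received H Ec w (fun j i => α j i ω) (fun j i => n j i ω))}

/-- `P_b(u)`: the expected number of wrong information bits due to branch `t`, when `w` is
transmitted. (It is not divided by the number `kc` of information bits of a branch.) -/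
noncomputable def Pb (C : ConvCode) (H : ℕ) (Ec N₀ u : ℝ) (pick : Finset C.Branch → C.Branch)
    (P : Measure Ω) (α n : Fin (H + C.m) → Fin C.nc → Ω → ℝ) (w : C.Input) (t : ℕ) : ℝ :=
  (∫⁻ ω, (C.bitErrors H (C.threshold N₀ u) pick (fun j i => α j i ω)
    (C.received H Ec w (fun j i => α j i ω) (fun j i => n j i ω)) w t : ENNReal) ∂P).toReal

end Performance

end ConvCode

/-- The modified Bessel function of the first kind of order zero. -/
noncomputable def besselI0 (x : ℝ) : ℝ :=
  1 / (2 * Real.pi) * ∫ θ in (-Real.pi)..Real.pi, Real.exp (x * Real.cos θ)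

/-- The Rician law with noncentrality parameter `s` and scale parameter `σ`. -/
noncomputable def ricianLaw (s σ : ℝ) : Measure ℝ :=
  (volume.restrict (Set.Ici 0)).withDensity fun r =>
    ENNReal.ofReal (r / σ ^ 2 * Real.exp (-((r ^ 2 + s ^ 2) / (2 * σ ^ 2)))
      * besselI0 (r * s / σ ^ 2))

/-- The Gaussian tail function `Q`. -/
noncomputable def gaussQ (x : ℝ) : ℝ :=
  1 / √(2 * Real.pi) * ∫ t in Set.Ioi x, Real.exp (-t ^ 2 / 2)

/-- The quantity `A`, with `ρ = E_c / N₀` and `v = u / d_f`. -/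
noncomputable def coefA (ρ v σ : ℝ) : ℝ :=
  1 / 2 * (√(2 * ρ) + v) ^ 2 + 1 / (2 * σ ^ 2)

/-- The quantity `B_θ`. -/
noncomputable def coefB (σ s θ : ℝ) : ℝ := -(s * Real.cos θ / σ ^ 2)

/-- The function `Λ`. -/
noncomputable def Lam (ρ v σ s θ : ℝ) : ℝ :=
  1 / (2 * coefA ρ v σ * σ ^ 2) *
    (1 - coefB σ s θ * √(2 * Real.pi) / √(2 * coefA ρ v σ)
      * Real.exp (coefB σ s θ ^ 2 / (4 * coefA ρ v σ))
      * gaussQ (coefB σ s θ / √(2 * coefA ρ v σ)))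

/-- The quantity `D̃(ρ, v, σ, s)`; here `s ^ 2 / (2 * σ ^ 2)` is the Rician factor. -/
noncomputable def Dtilde (ρ v σ s : ℝ) : ℝ :=
  1 / Real.pi * Real.exp (-(s ^ 2 / (2 * σ ^ 2))) * ∫ θ in (0 : ℝ)..Real.pi, Lam ρ v σ s θ

/-! ### Gaussian integrals on the half-line -/

section GaussianIntegrals

variable {A : ℝ}

/-! Every error event of the decoder is reduced to an event attached to a single detour, and these
are added up by a union bound.

The reduction uses two facts. By linearity of the code, adding a path to the transmitted one flips
exactly the symbols at the nonzero code bits of the added path (`symbol_splice`). Initial segments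
of survivors are survivors, so as long as the transmitted path survives, a competitor that meets it
at an earlier node coincides with it up to there; the difference is therefore one shifted detour
(`Survives.exists_detour`). All signal terms outside the support of the detour cancel, and the
decision that went wrong becomes `c * ∑ α ^ 2 ≤ ∑ ± α * n` over that support, with `c = √Ec + κ` for
an error and `c = √Ec - κ` for a retransmission (`Confused`).

The probability of this event is bounded by Chernoff's method (`measure_rician_gaussian_le`). Given
the fading, the Gaussian exponential moment leaves the factor `exp (-c ^ 2 * α ^ 2 / N₀)` per
position, and by independence the bound is a power of the Laplace transform of `α ^ 2`. Writing the
Bessel function in the Rician density as an integral over angles and integrating the radius first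
identifies this transform as `Dtilde` (`lintegral_ricianLaw_exp_neg_mul_sq`). The exponent is the
weight of the detour, so grouping detours by weight gives the coefficients `a` and `c`. -/

theorem neg_mul_sq_sub_mul_eq (hA : 0 < A) (B r : ℝ) :
    -(A * r ^ 2) - B * r = B ^ 2 / (4 * A) + -A * (r + B / (2 * A)) ^ 2 := by
  field_simp
  ring

theorem integrable_exp_neg_mul_sq_sub_mul (hA : 0 < A) (B : ℝ) :
    Integrable fun r : ℝ => Real.exp (-(A * r ^ 2) - B * r) := by
  simp_rw [neg_mul_sq_sub_mul_eq hA, Real.exp_add]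
  exact ((integrable_exp_neg_mul_sq hA).comp_add_right _).const_mul _

theorem integrable_mul_exp_neg_mul_sq_sub_mul (hA : 0 < A) (B : ℝ) :
    Integrable fun r : ℝ => r * Real.exp (-(A * r ^ 2) - B * r) := by
  have h := (((integrable_mul_exp_neg_mul_sq hA).comp_add_right (B / (2 * A))).const_mul
    (Real.exp (B ^ 2 / (4 * A)))).sub
    ((integrable_exp_neg_mul_sq_sub_mul hA B).const_mul (B / (2 * A)))
  refine h.congr (ae_of_all _ fun r => ?_)
  simp only [Pi.sub_apply, neg_mul_sq_sub_mul_eq hA, Real.exp_add]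
  ring

/-- Completing the square, the substitution `√(2 * A) * r + B / √(2 * A)` gives a standard Gaussian
tail. -/
theorem integral_Ioi_exp_neg_mul_sq_sub_mul (hA : 0 < A) (B : ℝ) :
    ∫ r in Set.Ioi (0 : ℝ), Real.exp (-(A * r ^ 2) - B * r) =
      √(2 * Real.pi) / √(2 * A) * Real.exp (B ^ 2 / (4 * A)) * gaussQ (B / √(2 * A)) := by
  set c := √(2 * A) with hc
  have hc0 : 0 < c := Real.sqrt_pos.2 (by positivity)
  have hc2 : c ^ 2 = 2 * A := Real.sq_sqrt (by positivity)
  have h1 (r : ℝ) : Real.exp (-(A * r ^ 2) - B * r) =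
      Real.exp (B ^ 2 / (4 * A)) * Real.exp (-(c * r + B / c) ^ 2 / 2) := by
    have hA' : A = c ^ 2 / 2 := by linarith
    rw [← Real.exp_add, hA']
    congr 1
    field_simp
    ring
  have h2 := integral_comp_mul_left_Ioi (fun x => Real.exp (-(x + B / c) ^ 2 / 2)) 0 hc0
  have h3 := (measurePreserving_add_right volume (B / c)).setIntegral_preimage_emb
    (measurableEmbedding_addRight _) (fun x => Real.exp (-x ^ 2 / 2)) (Set.Ioi (B / c))
  have hpi : √(2 * Real.pi) ≠ 0 := (Real.sqrt_pos.2 (by positivity)).ne'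
  simp only [Set.preimage_add_const_Ioi, sub_self] at h3
  simp_rw [h1, integral_const_mul]
  rw [h2, mul_zero, h3, gaussQ, smul_eq_mul]
  field_simp

/-- The exponential is, up to the factor `-1 / (2 * A)`, a primitive of `(r + B / (2 * A))` times
itself. Its boundary value at `0` gives the leading `1`, and the term with `B` is the previous
integral. -/
theorem integral_Ioi_mul_exp_neg_mul_sq_sub_mul (hA : 0 < A) (B : ℝ) :
    ∫ r in Set.Ioi (0 : ℝ), r * Real.exp (-(A * r ^ 2) - B * r) =
      1 / (2 * A) * (1 - B * √(2 * Real.pi) / √(2 * A) * Real.exp (B ^ 2 / (4 * A)) *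
        gaussQ (B / √(2 * A))) := by
  have hi1 := integrable_mul_exp_neg_mul_sq_sub_mul hA B
  have hi2 := (integrable_exp_neg_mul_sq_sub_mul hA B).const_mul (B / (2 * A))
  have hd (r : ℝ) : HasDerivAt (fun r => -(1 / (2 * A)) * Real.exp (-(A * r ^ 2) - B * r))
      (r * Real.exp (-(A * r ^ 2) - B * r) +
        B / (2 * A) * Real.exp (-(A * r ^ 2) - B * r)) r := by
    have h := ((((hasDerivAt_pow 2 r).const_mul A).neg.sub
      ((hasDerivAt_id r).const_mul B)).exp).const_mul (-(1 / (2 * A)))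
    refine h.congr_deriv ?_
    simp
    field_simp
    ring
  have hlim : Filter.Tendsto (fun r => -(1 / (2 * A)) * Real.exp (-(A * r ^ 2) - B * r))
      Filter.atTop (nhds 0) := by
    rw [← mul_zero (-(1 / (2 * A)))]
    refine (Real.tendsto_exp_atBot.comp ?_).const_mul _
    have h : (fun r : ℝ => -(A * r ^ 2) - B * r) = fun r => -((A * r + B) * r) := by
      ext r; ring
    rw [h, Filter.tendsto_neg_atBot_iff]
    exact ((Filter.tendsto_atTop_add_const_right _ _
      (Filter.tendsto_id.const_mul_atTop hA)).atTop_mul_atTop₀ Filter.tendsto_id)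
  have h := integral_Ioi_of_hasDerivAt_of_tendsto' (a := 0) (fun r _ => hd r)
    (hi1.add hi2).integrableOn hlim
  rw [integral_add hi1.integrableOn hi2.integrableOn, integral_const_mul,
    integral_Ioi_exp_neg_mul_sq_sub_mul hA] at h
  have h0 : (0 : ℝ) - -(1 / (2 * A)) * Real.exp (-(A * 0 ^ 2) - B * 0) = 1 / (2 * A) := by simp
  rw [h0] at h
  linear_combination h

theorem continuous_gaussQ : Continuous gaussQ := by
  have hi : Integrable fun t : ℝ => Real.exp (-t ^ 2 / 2) := by
    refine (integrable_exp_neg_mul_sq (b := 1 / 2) (by norm_num)).congr (ae_of_all _ fun t => ?_)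
    simp only
    congr 1; ring
  have h : gaussQ = fun x => 1 / √(2 * Real.pi) *
      ((∫ t in Set.Ioi (0 : ℝ), Real.exp (-t ^ 2 / 2)) -
        ∫ t in (0 : ℝ)..x, Real.exp (-t ^ 2 / 2)) := by
    ext x
    rw [gaussQ, eq_sub_of_add_eq' (intervalIntegral.integral_interval_add_Ioi
      (hi.integrableOn) (hi.integrableOn))]
  rw [h]
  exact continuous_const.mul (continuous_const.sub
    (intervalIntegral.continuous_primitive (fun _ _ => hi.intervalIntegrable) 0))

end GaussianIntegrals

/-! ### The Laplace transform of the squared Rician envelope -/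

section Rician

variable {ρ v σ s : ℝ}

theorem coefA_pos (hσ : 0 < σ) : 0 < coefA ρ v σ := by
  unfold coefA; positivity

theorem continuous_Lam (ρ v σ s : ℝ) : Continuous (Lam ρ v σ s) := by
  have hB : Continuous (coefB σ s) := by unfold coefB; fun_prop
  have hQ := continuous_gaussQ
  unfold Lam
  fun_prop

/-- This is the radial integral at a fixed angle. Nonnegativity, which the closed form hides, is
visible here. -/
theorem Lam_eq_integral (hσ : 0 < σ) (θ : ℝ) :
    Lam ρ v σ s θ = ∫ r in Set.Ioi (0 : ℝ),
      1 / σ ^ 2 * (r * Real.exp (-(coefA ρ v σ * r ^ 2) - coefB σ s θ * r)) := by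
  have hA := coefA_pos (ρ := ρ) (v := v) hσ
  rw [integral_const_mul, integral_Ioi_mul_exp_neg_mul_sq_sub_mul hA, Lam]
  field_simp

theorem Lam_nonneg (hσ : 0 < σ) (θ : ℝ) : 0 ≤ Lam ρ v σ s θ := by
  rw [Lam_eq_integral hσ]
  refine setIntegral_nonneg measurableSet_Ioi fun r hr => ?_
  have : (0 : ℝ) < r := hr
  positivity

theorem Dtilde_nonneg (hσ : 0 < σ) : 0 ≤ Dtilde ρ v σ s := by
  have h : 0 ≤ ∫ θ in (0 : ℝ)..Real.pi, Lam ρ v σ s θ :=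
    intervalIntegral.integral_nonneg Real.pi_pos.le fun θ _ => Lam_nonneg hσ θ
  have := Real.pi_pos
  unfold Dtilde
  positivity

/-- Evenness of the cosine passes to the full circle, the range of integration in `besselI0`. -/
theorem Dtilde_eq_integral_symm :
    Dtilde ρ v σ s = ∫ θ in (-Real.pi)..Real.pi,
      1 / (2 * Real.pi) * Real.exp (-(s ^ 2 / (2 * σ ^ 2))) * Lam ρ v σ s θ := by
  have hi (a b : ℝ) := (continuous_Lam ρ v σ s).intervalIntegrable (μ := volume) a b
  have heven : ∫ θ in (-Real.pi)..0, Lam ρ v σ s θ = ∫ θ in (0 : ℝ)..Real.pi, Lam ρ v σ s θ := by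
    have h := intervalIntegral.integral_comp_neg (a := 0) (b := Real.pi) (Lam ρ v σ s)
    rw [neg_zero] at h
    rw [← h]
    simp only [Lam, coefB, Real.cos_neg]
  rw [intervalIntegral.integral_const_mul,
    ← intervalIntegral.integral_add_adjacent_intervals (hi _ 0) (hi _ _), heven, Dtilde]
  ring

theorem continuous_besselI0 : Continuous besselI0 := by
  unfold besselI0
  exact continuous_const.mul
    (intervalIntegral.continuous_parametric_intervalIntegral_of_continuous' (by fun_prop) _ _)

/-- With the integral for the Bessel function inserted, the integrand is nonnegative in radius and
angle, so Tonelli allows the radius to be integrated first. The shape of `c` is what the Chernoff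
exponent produces. -/
theorem lintegral_ricianLaw_exp_neg_mul_sq (hσ : 0 < σ) {c : ℝ}
    (hc : c = 1 / 2 * (√(2 * ρ) + v) ^ 2) :
    ∫⁻ r, ENNReal.ofReal (Real.exp (-(c * r ^ 2))) ∂(ricianLaw s σ) =
      ENNReal.ofReal (Dtilde ρ v σ s) := by
  have hπ := Real.pi_pos
  set K := 1 / (2 * Real.pi) * Real.exp (-(s ^ 2 / (2 * σ ^ 2))) with hK
  have hK0 : 0 ≤ K := by positivity
  set F : ℝ → ℝ → ℝ := fun r θ =>
    K * (1 / σ ^ 2 * (r * Real.exp (-(coefA ρ v σ * r ^ 2) - coefB σ s θ * r))) with hF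
  have hFc : Continuous (Function.uncurry F) := by
    simp only [hF, coefB, Function.uncurry_def]; fun_prop
  have hF0 {r : ℝ} (hr : 0 ≤ r) (θ : ℝ) : 0 ≤ F r θ := by simp only [hF]; positivity
  have hdens : Measurable fun r : ℝ => ENNReal.ofReal
      (r / σ ^ 2 * Real.exp (-((r ^ 2 + s ^ 2) / (2 * σ ^ 2))) * besselI0 (r * s / σ ^ 2)) := by
    have := continuous_besselI0
    fun_prop
  have hinner (r : ℝ) (hr : 0 ≤ r) : ENNReal.ofReal
      (r / σ ^ 2 * Real.exp (-((r ^ 2 + s ^ 2) / (2 * σ ^ 2))) * besselI0 (r * s / σ ^ 2)) *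
        ENNReal.ofReal (Real.exp (-(c * r ^ 2))) =
      ∫⁻ θ in Set.Ioc (-Real.pi) Real.pi, ENNReal.ofReal (F r θ) := by
    have hcont : Continuous (F r) := hFc.comp (by fun_prop : Continuous fun θ => (r, θ))
    rw [← ENNReal.ofReal_mul' (Real.exp_pos _).le, ← ofReal_integral_eq_lintegral_ofReal
      (hcont.integrableOn_Ioc) (ae_of_all _ (hF0 hr)),
      ← intervalIntegral.integral_of_le (by linarith), besselI0]
    congr 1
    rw [mul_comm _ (Real.exp (-(c * r ^ 2))), ← mul_assoc, ← mul_assoc,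
      ← intervalIntegral.integral_const_mul]
    refine intervalIntegral.integral_congr fun θ _ => ?_
    simp only [hF, hK]
    -- The Laplace exponent and the Rician exponent add up to the quadratic coefficient `coefA`; the
    -- Bessel exponent is the linear term with `coefB`.
    have hexp : Real.exp (-(coefA ρ v σ * r ^ 2) - coefB σ s θ * r) *
        Real.exp (-(s ^ 2 / (2 * σ ^ 2))) = Real.exp (-(c * r ^ 2)) *
        Real.exp (-((r ^ 2 + s ^ 2) / (2 * σ ^ 2))) *
        Real.exp (r * s / σ ^ 2 * Real.cos θ) := by
      simp only [← Real.exp_add]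
      congr 1
      simp only [coefA, coefB, ← hc]
      field_simp
      ring
    linear_combination (-(1 / (2 * Real.pi) * (r / σ ^ 2))) * hexp
  have houter (θ : ℝ) : ∫⁻ r in Set.Ioi 0, ENNReal.ofReal (F r θ) =
      ENNReal.ofReal (K * Lam ρ v σ s θ) := by
    have hi : Integrable fun r => F r θ :=
      ((integrable_mul_exp_neg_mul_sq_sub_mul (coefA_pos hσ) _).const_mul _).const_mul _
    rw [← ofReal_integral_eq_lintegral_ofReal hi.integrableOn
      ((ae_restrict_iff' measurableSet_Ioi).2 (ae_of_all _ fun r hr => hF0 (le_of_lt hr) θ)),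
      Lam_eq_integral hσ, ← integral_const_mul]
  rw [ricianLaw, lintegral_withDensity_eq_lintegral_mul _ hdens (by fun_prop)]
  simp only [Pi.mul_apply]
  rw [setLIntegral_congr_fun measurableSet_Ici (fun r hr => hinner r hr),
    setLIntegral_congr Ioi_ae_eq_Ici.symm,
    lintegral_lintegral_swap (by exact hFc.measurable.ennreal_ofReal.aemeasurable)]
  simp_rw [houter]
  rw [Dtilde_eq_integral_symm, intervalIntegral.integral_of_le (by linarith),
    ofReal_integral_eq_lintegral_ofReal]
  · exact (continuous_const.mul (continuous_Lam ρ v σ s)).integrableOn_Ioc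
  · exact ae_of_all _ fun θ => mul_nonneg hK0 (Lam_nonneg hσ θ)

end Rician

/-! ### A Chernoff bound for independent Rician fading and Gaussian noise -/

section Chernoff

theorem lintegral_pi_prod_eq_prod_lintegral {ι : Type*} [Fintype ι] {β : ι → Type*}
    [∀ i, MeasurableSpace (β i)] (μ : ∀ i, Measure (β i)) [∀ i, IsProbabilityMeasure (μ i)]
    (S : Finset ι) {f : ∀ i, β i → ENNReal} (hf : ∀ i, Measurable (f i)) :
    ∫⁻ x, ∏ i ∈ S, f i (x i) ∂(Measure.pi μ) = ∏ i ∈ S, ∫⁻ y, f i y ∂(μ i) := by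
  have hind : iIndepFun (fun i (x : ∀ i, β i) => f i (x i)) (Measure.pi μ) :=
    iIndepFun_pi fun i => (hf i).aemeasurable
  rw [lintegral_prod_eq_prod_lintegral_of_indepFun S _ hind
    fun i => (hf i).comp (measurable_pi_apply i)]
  exact Finset.prod_congr rfl fun i _ => (measurePreserving_eval μ i).lintegral_comp (hf i)

variable {Ω ι : Type*} [MeasurableSpace Ω] {P : Measure Ω} [IsProbabilityMeasure P] [Fintype ι]
  {α n : ι → Ω → ℝ}

/-- The joint law is a product measure on `ι ⊕ ι`. Separating fading from noise lets the noise be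
integrated out at fixed fading, and then the fading, one position at a time. -/
theorem ProbabilityTheory.iIndepFun.lintegral_prod_sumElim {μ ν : Measure ℝ}
    (hα : ∀ q, HasLaw (α q) μ P) (hn : ∀ q, HasLaw (n q) ν P)
    (hindep : iIndepFun (Sum.elim α n) P) (S : Finset ι) {g : ι → ℝ → ℝ → ENNReal}
    (hg : ∀ q, Measurable (Function.uncurry (g q))) :
    ∫⁻ ω, ∏ q ∈ S, g q (α q ω) (n q ω) ∂P = ∏ q ∈ S, ∫⁻ a, ∫⁻ z, g q a z ∂ν ∂μ := by
  have hX : ∀ i, AEMeasurable (Sum.elim α n i) P := by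
    rintro (q | q)
    exacts [(hα q).aemeasurable, (hn q).aemeasurable]
  have hprob (i : ι ⊕ ι) : IsProbabilityMeasure (P.map (Sum.elim α n i)) :=
    Measure.isProbabilityMeasure_map (hX i)
  have hmp := measurePreserving_sumPiEquivProdPi (fun i : ι ⊕ ι => P.map (Sum.elim α n i))
  have hG : Measurable fun x : (ι → ℝ) × (ι → ℝ) => ∏ q ∈ S, g q (x.1 q) (x.2 q) :=
    Finset.measurable_prod _ fun q _ => (hg q).comp
      (by fun_prop : Measurable fun x : (ι → ℝ) × (ι → ℝ) => (x.1 q, x.2 q))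
  have hprobα (q : ι) : IsProbabilityMeasure (P.map (α q)) := hprob (Sum.inl q)
  have hprobn (q : ι) : IsProbabilityMeasure (P.map (n q)) := hprob (Sum.inr q)
  calc ∫⁻ ω, ∏ q ∈ S, g q (α q ω) (n q ω) ∂P
      = ∫⁻ x, ∏ q ∈ S, g q (x (Sum.inl q)) (x (Sum.inr q))
          ∂(P.map fun ω i => Sum.elim α n i ω) := by
        exact (lintegral_map' (hG.comp hmp.measurable).aemeasurable
          (aemeasurable_pi_lambda _ hX)).symm
    _ = ∫⁻ x : (ι → ℝ) × (ι → ℝ), ∏ q ∈ S, g q (x.1 q) (x.2 q)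
          ∂((Measure.pi fun q => P.map (α q)).prod (Measure.pi fun q => P.map (n q))) := by
        rw [hindep.map_fun_eq_pi_map hX]
        exact hmp.lintegral_comp hG
    _ = ∫⁻ a, ∏ q ∈ S, ∫⁻ z, g q (a q) z ∂(P.map (n q)) ∂(Measure.pi fun q => P.map (α q)) := by
        rw [lintegral_prod _ hG.aemeasurable]
        refine lintegral_congr fun a => ?_
        exact lintegral_pi_prod_eq_prod_lintegral (fun q => P.map (n q)) S
          (f := fun q z => g q (a q) z) fun q => (hg q).comp measurable_prodMk_left
    _ = ∏ q ∈ S, ∫⁻ a, ∫⁻ z, g q a z ∂(P.map (n q)) ∂(P.map (α q)) :=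
        lintegral_pi_prod_eq_prod_lintegral (fun q => P.map (α q)) S
          (f := fun q a => ∫⁻ z, g q a z ∂(P.map (n q))) fun q => (hg q).lintegral_prod_right'
    _ = _ := by simp_rw [(hα _).map_eq, (hn _).map_eq]

theorem lintegral_gaussianReal_exp_mul {v : NNReal} (t : ℝ) :
    ∫⁻ z, ENNReal.ofReal (Real.exp (t * z)) ∂(gaussianReal 0 v) =
      ENNReal.ofReal (Real.exp (v * t ^ 2 / 2)) := by
  rw [← ofReal_integral_eq_lintegral_ofReal (integrable_exp_mul_gaussianReal t)
    (ae_of_all _ fun z => (Real.exp_pos _).le)]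
  have h := congrFun (mgf_id_gaussianReal (μ := 0) (v := v)) t
  simp only [mgf, id, zero_mul, zero_add] at h
  rw [h]

/-- Chernoff's bound: the indicator is at most the exponential of `l` times the excess of the right
side over the left. The signs `ε` enter the Gaussian moment only through their squares. -/
theorem measure_rician_gaussian_le {N₀ σ s ρ v c : ℝ} (hN₀ : 0 < N₀) (hσ : 0 < σ) (hc : 0 ≤ c)
    (hcv : c ^ 2 / N₀ = 1 / 2 * (√(2 * ρ) + v) ^ 2)
    (hα : ∀ q, HasLaw (α q) (ricianLaw s σ) P)
    (hn : ∀ q, HasLaw (n q) (gaussianReal 0 (N₀ / 2).toNNReal) P)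
    (hindep : iIndepFun (Sum.elim α n) P) (S : Finset ι) {ε : ι → ℝ} (hε : ∀ q, ε q ^ 2 = 1) :
    P {ω | c * ∑ q ∈ S, α q ω ^ 2 ≤ ∑ q ∈ S, ε q * α q ω * n q ω} ≤
      ENNReal.ofReal (Dtilde ρ v σ s ^ S.card) := by
  -- For fading `a` the exponent is `-l * c * a ^ 2 + l ^ 2 * a ^ 2 * N₀ / 4`. This `l` minimises it
  -- for every `a` at once, with value `-c ^ 2 * a ^ 2 / N₀`.
  set l := 2 * c / N₀ with hl
  have hl0 : 0 ≤ l := by positivity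
  set g : ι → ℝ → ℝ → ENNReal := fun q a z =>
    ENNReal.ofReal (Real.exp (l * (ε q * a * z - c * a ^ 2))) with hg
  have hgm (q : ι) : Measurable (Function.uncurry (g q)) := by
    simp only [hg, Function.uncurry_def]; fun_prop
  have hle : ∫⁻ ω, {ω | c * ∑ q ∈ S, α q ω ^ 2 ≤ ∑ q ∈ S, ε q * α q ω * n q ω}.indicator 1 ω ∂P ≤
      ∫⁻ ω, ∏ q ∈ S, g q (α q ω) (n q ω) ∂P := by
    refine lintegral_mono fun ω => ?_
    by_cases hω : ω ∈ {ω | c * ∑ q ∈ S, α q ω ^ 2 ≤ ∑ q ∈ S, ε q * α q ω * n q ω}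
    swap
    · rw [Set.indicator_of_notMem hω]
      exact zero_le
    rw [Set.indicator_of_mem hω]
    simp only [hg, Pi.one_apply, Set.mem_ofPred_eq] at hω ⊢
    rw [← ENNReal.ofReal_prod_of_nonneg fun _ _ => (Real.exp_pos _).le, ← Real.exp_sum,
      ← Finset.mul_sum, Finset.sum_sub_distrib, ← Finset.mul_sum, ENNReal.one_le_ofReal,
      Real.one_le_exp_iff]
    exact mul_nonneg hl0 (sub_nonneg.2 hω)
  have hfac (q : ι) : ∫⁻ a, ∫⁻ z, g q a z ∂(gaussianReal 0 (N₀ / 2).toNNReal) ∂(ricianLaw s σ) =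
      ENNReal.ofReal (Dtilde ρ v σ s) := by
    rw [← lintegral_ricianLaw_exp_neg_mul_sq hσ hcv]
    refine lintegral_congr fun a => ?_
    have h1 (z : ℝ) : g q a z = ENNReal.ofReal (Real.exp (-(l * c * a ^ 2))) *
        ENNReal.ofReal (Real.exp (l * ε q * a * z)) := by
      simp only [hg]
      rw [← ENNReal.ofReal_mul (Real.exp_pos _).le, ← Real.exp_add]
      congr 2; ring
    simp_rw [h1]
    rw [lintegral_const_mul _ (by fun_prop), lintegral_gaussianReal_exp_mul,
      ← ENNReal.ofReal_mul (Real.exp_pos _).le, ← Real.exp_add,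
      Real.coe_toNNReal _ (by positivity)]
    congr 2
    simp only [mul_pow, hε q, hl]
    field_simp
    ring
  calc P {ω | c * ∑ q ∈ S, α q ω ^ 2 ≤ ∑ q ∈ S, ε q * α q ω * n q ω}
      ≤ ∫⁻ ω, {ω | c * ∑ q ∈ S, α q ω ^ 2 ≤ ∑ q ∈ S, ε q * α q ω * n q ω}.indicator 1 ω ∂P := by
        have hm : NullMeasurableSet
            {ω | c * ∑ q ∈ S, α q ω ^ 2 ≤ ∑ q ∈ S, ε q * α q ω * n q ω} P := by
          refine nullMeasurableSet_le ?_ ?_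
          · exact (Finset.aemeasurable_fun_sum _ fun q _ =>
              (hα q).aemeasurable.pow_const 2).const_mul c
          · exact Finset.aemeasurable_fun_sum _ fun q _ =>
              ((hα q).aemeasurable.const_mul _).mul (hn q).aemeasurable
        rw [lintegral_indicator_one₀ hm]
    _ ≤ _ := hle
    _ = _ := by
        rw [hindep.lintegral_prod_sumElim hα hn S hgm, Finset.prod_congr rfl fun q _ => hfac q,
          Finset.prod_const, ENNReal.ofReal_pow (Dtilde_nonneg hσ)]

end Chernoff

namespace ConvCode

variable {C : ConvCode}

/-! ### Trellis paths -/

section Trellis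

theorem branch_congr {p q : C.Input} {j : ℕ} (h : ∀ k ≤ j, p k = q k) :
    C.branch p j = C.branch q j := by
  funext l
  simp only [branch]
  rw [h (j - l) (Nat.sub_le _ _)]

theorem state_congr {p q : C.Input} {t : ℕ} (h : ∀ k < t, p k = q k) :
    C.state p t = C.state q t := by
  funext l
  simp only [state]
  split_ifs with hl
  · exact h _ (by omega)
  · rfl

theorem symbol_congr {p q : C.Input} {j : ℕ} (h : ∀ k ≤ j, p k = q k) (i : Fin C.nc) :
    C.symbol p j i = C.symbol q j i := by
  unfold symbol codeBit
  rw [branch_congr h]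

theorem target_branch (p : C.Input) (t : ℕ) : C.target (C.branch p t) = C.state p (t + 1) := by
  funext l
  simp [target, branch, state]

theorem source_branch (p : C.Input) (t : ℕ) : C.source (C.branch p t) = C.state p t := by
  funext l
  simp only [source, branch, state, Fin.val_succ, Nat.succ_le_iff, Nat.sub_sub, Nat.add_comm 1]

theorem branch_zero (p : C.Input) (t : ℕ) : C.branch p t 0 = p t := by
  simp [branch]

theorem eq_of_source_eq {e e' : C.Branch} (h0 : e 0 = e' 0) (h : C.source e = C.source e') :
    e = e' := by
  funext l
  refine Fin.cases h0 (fun k => ?_) l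
  exact congrFun h k

theorem output_add (e e' : C.Branch) (i : Fin C.nc) :
    C.output (e + e') i = C.output e i + C.output e' i := by
  simp only [output, Pi.add_apply, add_mul, Finset.sum_add_distrib]

theorem output_zero (i : Fin C.nc) : C.output 0 i = 0 := by
  simp [output]

/-- The path that follows `w` and adds the path `d` to it from level `t₀` on. -/
def splice (w d : C.Input) (t₀ : ℕ) : C.Input :=
  fun j => if j < t₀ then w j else w j + d (j - t₀)

/-- The encoder is linear and time-invariant, and `branch` pads with zeros before the start of `d`,
so the shifted register of `d` is simply added. -/
theorem codeBit_splice (w d : C.Input) (t₀ j : ℕ) (i : Fin C.nc) :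
    C.codeBit (splice w d t₀) j i =
      C.codeBit w j i + if t₀ ≤ j then C.codeBit d (j - t₀) i else 0 := by
  have h : C.branch (splice w d t₀) j =
      C.branch w j + if t₀ ≤ j then C.branch d (j - t₀) else 0 := by
    funext l
    by_cases hj : t₀ ≤ j
    · simp only [branch, splice, if_pos hj, Pi.add_apply]
      by_cases hl : (l : ℕ) ≤ j
      · by_cases hl' : (l : ℕ) ≤ j - t₀
        · have h1 : ¬ j - l < t₀ := by omega
          have h2 : j - l - t₀ = j - t₀ - l := by omega
          simp [hl, hl', h1, h2]
        · have h1 : j - l < t₀ := by omega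
          simp [hl, hl', h1]
      · have hl' : ¬ (l : ℕ) ≤ j - t₀ := by omega
        simp [hl, hl']
    · have h1 : j - l < t₀ := by omega
      simp [branch, splice, hj, h1]
  simp only [codeBit, h, output_add]
  split_ifs <;> simp [output_zero]

theorem symbol_sq (p : C.Input) (j : ℕ) (i : Fin C.nc) : C.symbol p j i ^ 2 = 1 := by
  unfold symbol
  split_ifs <;> norm_num

theorem symbol_splice (w d : C.Input) (t₀ j : ℕ) (i : Fin C.nc) :
    C.symbol (splice w d t₀) j i =
      if t₀ ≤ j ∧ C.codeBit d (j - t₀) i ≠ 0 then -C.symbol w j i else C.symbol w j i := by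
  have key : ∀ x y : ZMod 2, y ≠ 0 → (x + y = 0 ↔ x ≠ 0) := by decide
  simp only [symbol, codeBit_splice]
  by_cases hj : t₀ ≤ j
  · by_cases hc : C.codeBit d (j - t₀) i = 0
    · simp [hc]
    · simp only [hj, hc, if_true, key _ _ hc, true_and, ne_eq, not_false_eq_true]
      by_cases hw : C.codeBit w j i = 0 <;> simp [hw]
  · simp [hj]

/-- Two paths which enter the same node, and which agree up to each earlier node that they share,
differ by a detour. -/
theorem exists_detour {p w : C.Input} {T : ℕ} (hT : C.state p T = C.state w T)
    (hne : ∃ j < T, p j ≠ w j)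
    (hpre : ∀ t < T, C.state p t = C.state w t → ∀ j < t, p j = w j) :
    ∃ d : ℕ × C.Input, C.IsDetour d.1 d.2 ∧ d.1 ≤ T ∧
      ∀ j < T, p j = splice w d.2 (T - d.1) j := by
  classical
  obtain ⟨j₀, hj₀, hj₀ne⟩ := hne
  -- The detour starts at the last common node before `T`; level `0` is always common.
  obtain ⟨t₀, ht₀, hmax⟩ := Finset.exists_max_image
    ((Finset.range T).filter fun t => C.state p t = C.state w t) id
    ⟨0, by simp only [Finset.mem_filter, Finset.mem_range]; exact ⟨by omega, by funext l; simp [state]⟩⟩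
  simp only [Finset.mem_filter, Finset.mem_range, id, and_imp] at ht₀ hmax
  obtain ⟨ht₀T, hst⟩ := ht₀
  have hagree := hpre t₀ ht₀T hst
  set d : C.Input := fun j => if j < T - t₀ then p (t₀ + j) - w (t₀ + j) else 0 with hd
  -- Register cells reaching back before `t₀` contribute nothing, because the paths agree there.
  have hstate (t : ℕ) (ht : t ≤ T - t₀) :
      C.state d t = C.state p (t₀ + t) - C.state w (t₀ + t) := by
    funext l
    simp only [state, Pi.sub_apply, hd]
    by_cases hl : (l : ℕ) < t
    · have h1 : (l : ℕ) < t₀ + t := by omega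
      have h2 : t - 1 - l < T - t₀ := by omega
      have h3 : t₀ + (t - 1 - l) = t₀ + t - 1 - l := by omega
      simp [hl, h1, h2, h3]
    · by_cases h1 : (l : ℕ) < t₀ + t
      · simp [hl, h1, hagree (t₀ + t - 1 - l) (by omega)]
      · simp [hl, h1]
  refine ⟨(T - t₀, d), ⟨by simp only; omega, ?_, ?_, ?_, ?_⟩, Nat.sub_le _ _, ?_⟩
  · intro h0
    simp only [hd, add_zero, if_pos (Nat.sub_pos_of_lt ht₀T), sub_eq_zero] at h0
    -- If the first block of the difference vanished, the paths would agree up to level `t₀ + 1`,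
    -- against the maximality of `t₀`, or against `hne` when `t₀ + 1 = T`.
    have hag' : ∀ j < t₀ + 1, p j = w j := fun j hj => by
      rcases Nat.lt_succ_iff_lt_or_eq.1 hj with h | rfl
      exacts [hagree j h, h0]
    rcases Nat.lt_or_ge (t₀ + 1) T with h | h
    · have := hmax (t₀ + 1) h (state_congr hag')
      omega
    · exact hj₀ne (hag' _ (by omega))
  · intro t h1 h2 h
    simp only at h2
    rw [hstate t h2.le, sub_eq_zero] at h
    have := hmax (t₀ + t) (by omega) h
    omega
  · simp only
    rw [hstate _ le_rfl, Nat.add_sub_cancel' ht₀T.le, hT, sub_self]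
  · intro j hj
    simp only at hj
    simp [hd, not_lt.2 hj]
  · intro j hj
    have h1 : T - (T - t₀) = t₀ := by omega
    simp only [h1, splice, hd]
    split_ifs with h2 h3
    · exact hagree j h2
    · rw [Nat.add_sub_cancel' (not_lt.1 h2)]
      abel
    · omega

/-- The nonzero first block stays in the register for `m` levels. This is why only `H` levels count
for the frame. -/
theorem IsDetour.memory_lt {L : ℕ} {d : C.Input} (h : C.IsDetour L d) : C.m < L := by
  by_contra hL
  have hpos := h.pos
  have h1 := congrFun h.merges ⟨L - 1, by omega⟩
  simp only [state] at h1
  rw [if_pos (by omega), Nat.sub_self] at h1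
  exact h.leaves h1

theorem infoWeight_eq_card_ne {p w d : C.Input} {T L : ℕ} (hL : L ≤ T)
    (hp : ∀ j < T, p j = splice w d (T - L) j) :
    ∑ j ∈ Finset.range T, (Finset.univ.filter fun b => p j b ≠ w j b).card =
      C.infoWeight L d := by
  obtain ⟨t₀, rfl⟩ : ∃ t₀, T = t₀ + L := ⟨T - L, by omega⟩
  rw [Nat.add_sub_cancel] at hp
  rw [Finset.sum_range_add, Finset.sum_eq_zero, zero_add, infoWeight]
  · refine Finset.sum_congr rfl fun j hj => ?_
    rw [Finset.mem_range] at hj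
    rw [hp _ (by omega)]
    simp [splice]
  · intro j hj
    rw [Finset.mem_range] at hj
    rw [hp _ (by omega)]
    simp [splice, hj]

end Trellis

/-! ### The code symbols in which a detour differs from the transmitted path -/

section Difference

variable {H : ℕ}

/-- The positions of the nonzero code bits of the path `d`, of length `L`, when it is shifted so as
to end at level `T`. -/
def support (C : ConvCode) (H T L : ℕ) (d : C.Input) : Finset (Fin (H + C.m) × Fin C.nc) :=
  Finset.univ.filter fun q =>
    q.1.val < T ∧ T - L ≤ q.1.val ∧ C.codeBit d (q.1.val - (T - L)) q.2 ≠ 0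

theorem card_support {T L : ℕ} (hL : L ≤ T) (hT : T ≤ H + C.m) (d : C.Input) :
    (C.support H T L d).card = C.weight L d := by
  rw [weight, ← Finset.card_sigma]
  refine Finset.card_bij (fun q _ => ⟨q.1.val - (T - L), q.2⟩) ?_ ?_ ?_
  · intro q hq
    simp only [support, Finset.mem_filter, Finset.mem_univ, true_and] at hq
    simp only [Finset.mem_sigma, Finset.mem_range, Finset.mem_filter, Finset.mem_univ, true_and]
    exact ⟨by omega, hq.2.2⟩
  · rintro ⟨a, b⟩ hq ⟨a', b'⟩ hq' h
    simp only [support, Finset.mem_filter, Finset.mem_univ, true_and] at hq hq'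
    simp only [Sigma.mk.injEq, heq_eq_eq] at h
    ext
    · simp only; omega
    · simp only [h.2]
  · rintro ⟨j, i⟩ h
    simp only [Finset.mem_sigma, Finset.mem_range, Finset.mem_filter, Finset.mem_univ,
      true_and] at h
    refine ⟨(⟨T - L + j, by omega⟩, i), ?_, ?_⟩
    · simp only [support, Finset.mem_filter, Finset.mem_univ, true_and, Nat.add_sub_cancel_left]
      exact ⟨by omega, by omega, h.2⟩
    · simp

theorem sum_ite_eq_sum_support (T L : ℕ) (d : C.Input) (G : Fin (H + C.m) → Fin C.nc → ℝ) :
    (∑ j : Fin (H + C.m) with j.val < T, ∑ i,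
      if T - L ≤ j.val ∧ C.codeBit d (j.val - (T - L)) i ≠ 0 then G j i else 0) =
      ∑ q ∈ C.support H T L d, G q.1 q.2 := by
  rw [support, Finset.sum_filter, Finset.sum_filter, Fintype.sum_prod_type]
  refine Finset.sum_congr rfl fun j _ => ?_
  by_cases hj : j.val < T <;> simp [hj]

/-- The condition, on the fading `f` and the noise `z`, under which a shifted detour is at least
as close to the received word as the transmitted path `w`, up to a change of gain. -/
def Confused (C : ConvCode) (H : ℕ) (w : C.Input) (T : ℕ) (c : ℝ)
    (f z : Fin (H + C.m) → Fin C.nc → ℝ) (d : ℕ × C.Input) : Prop :=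
  d.1 ≤ T ∧ c * ∑ q ∈ C.support H T d.1 d.2, f q.1 q.2 ^ 2 ≤
    ∑ q ∈ C.support H T d.1 d.2, -C.symbol w q.1 q.2 * f q.1 q.2 * z q.1 q.2

variable {p w : C.Input} {T : ℕ} {d : ℕ × C.Input}

theorem symbol_of_splice (hp : ∀ j < T, p j = splice w d.2 (T - d.1) j) {j : ℕ} (hj : j < T)
    (i : Fin C.nc) : C.symbol p j i =
      if T - d.1 ≤ j ∧ C.codeBit d.2 (j - (T - d.1)) i ≠ 0 then -C.symbol w j i
        else C.symbol w j i := by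
  rw [← symbol_splice]
  exact symbol_congr (fun k hk => hp k (by omega)) i

/-- Off the support the terms vanish. On it the symbol difference is `-2` times the transmitted
symbol, whose square is `1`, which leaves the signal term `√Ec * f ^ 2`. -/
theorem sum_symbol_sub (hp : ∀ j < T, p j = splice w d.2 (T - d.1) j) (Ec : ℝ)
    (f z : Fin (H + C.m) → Fin C.nc → ℝ) :
    (∑ j : Fin (H + C.m) with j.val < T, ∑ i,
      f j i * (C.symbol p j i - C.symbol w j i) * C.received H Ec w f z j i) =
      2 * (∑ q ∈ C.support H T d.1 d.2, -C.symbol w q.1 q.2 * f q.1 q.2 * z q.1 q.2 -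
        √Ec * ∑ q ∈ C.support H T d.1 d.2, f q.1 q.2 ^ 2) := by
  rw [Finset.mul_sum, ← Finset.sum_sub_distrib, Finset.mul_sum, ← sum_ite_eq_sum_support T d.1 d.2
    (fun j i => 2 * (-C.symbol w j i * f j i * z j i - √Ec * f j i ^ 2))]
  refine Finset.sum_congr rfl fun j hj => Finset.sum_congr rfl fun i _ => ?_
  rw [symbol_of_splice hp (Finset.mem_filter.1 hj).2, received]
  split_ifs
  · linear_combination (-2 * √Ec * f j i ^ 2) * C.symbol_sq w j i
  · ring

theorem sum_abs_symbol_sub (hp : ∀ j < T, p j = splice w d.2 (T - d.1) j)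
    (f : Fin (H + C.m) → Fin C.nc → ℝ) :
    (∑ j : Fin (H + C.m) with j.val < T, ∑ i,
      |C.symbol p j i - C.symbol w j i| * f j i ^ 2) =
      2 * ∑ q ∈ C.support H T d.1 d.2, f q.1 q.2 ^ 2 := by
  rw [Finset.mul_sum, ← sum_ite_eq_sum_support T d.1 d.2 (fun j i => 2 * f j i ^ 2)]
  refine Finset.sum_congr rfl fun j hj => Finset.sum_congr rfl fun i _ => ?_
  rw [symbol_of_splice hp (Finset.mem_filter.1 hj).2]
  split_ifs
  · have h : |-C.symbol w j i - C.symbol w j i| = 2 := by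
      unfold symbol
      split_ifs <;> norm_num
    rw [h]
  · simp

theorem metric_sub_metric (f y : Fin (H + C.m) → Fin C.nc → ℝ) (T : ℕ) (p w : C.Input) :
    C.metric H f y T p - C.metric H f y T w = ∑ j : Fin (H + C.m) with j.val < T, ∑ i,
      f j i * (C.symbol p j i - C.symbol w j i) * y j i := by
  simp only [metric, ← Finset.sum_sub_distrib]
  refine Finset.sum_congr rfl fun j hj => Finset.sum_congr rfl fun i _ => ?_
  ring

theorem passesTest_iff (κ : ℝ) (f y : Fin (H + C.m) → Fin C.nc → ℝ) (T : ℕ) (p w : C.Input) :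
    C.PassesTest H κ f y T p w ↔ κ * (∑ j : Fin (H + C.m) with j.val < T, ∑ i,
      |C.symbol p j i - C.symbol w j i| * f j i ^ 2) ≤
        C.metric H f y T p - C.metric H f y T w := by
  simp only [PassesTest, metric_sub_metric, abs_sub_comm]

theorem metric_congr (f y : Fin (H + C.m) → Fin C.nc → ℝ) {q : C.Input}
    (h : ∀ j < T, p j = q j) : C.metric H f y T p = C.metric H f y T q := by
  refine Finset.sum_congr rfl fun j hj => Finset.sum_congr rfl fun i _ => ?_
  rw [symbol_congr fun k hk => h k (lt_of_le_of_lt hk (Finset.mem_filter.1 hj).2)]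

theorem PassesTest.congr {κ : ℝ} {f y : Fin (H + C.m) → Fin C.nc → ℝ} {p' q q' : C.Input}
    (h : C.PassesTest H κ f y T p q) (hp : ∀ j < T, p j = p' j) (hq : ∀ j < T, q j = q' j) :
    C.PassesTest H κ f y T p' q' := by
  rw [passesTest_iff] at h ⊢
  rw [← metric_congr f y hp, ← metric_congr f y hq]
  refine le_trans (le_of_eq ?_) h
  congr 1
  refine Finset.sum_congr rfl fun j hj => Finset.sum_congr rfl fun i _ => ?_
  have hj' := (Finset.mem_filter.1 hj).2
  rw [symbol_congr fun k hk => hp k (lt_of_le_of_lt hk hj'),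
    symbol_congr fun k hk => hq k (lt_of_le_of_lt hk hj')]

variable {Ec κ : ℝ} {f z : Fin (H + C.m) → Fin C.nc → ℝ}

theorem confused_of_passesTest (hL : d.1 ≤ T) (hp : ∀ j < T, p j = splice w d.2 (T - d.1) j)
    (h : C.PassesTest H κ f (C.received H Ec w f z) T p w) :
    C.Confused H w T (√Ec + κ) f z d := by
  rw [passesTest_iff, metric_sub_metric, sum_symbol_sub hp, sum_abs_symbol_sub hp] at h
  exact ⟨hL, by linarith⟩

theorem confused_of_not_passesTest (hL : d.1 ≤ T) (hp : ∀ j < T, p j = splice w d.2 (T - d.1) j)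
    (h : ¬ C.PassesTest H κ f (C.received H Ec w f z) T w p) :
    C.Confused H w T (√Ec - κ) f z d := by
  have h1 := metric_sub_metric f (C.received H Ec w f z) T p w
  rw [sum_symbol_sub hp] at h1
  rw [passesTest_iff] at h
  simp_rw [abs_sub_comm (C.symbol w _ _)] at h
  rw [sum_abs_symbol_sub hp] at h
  exact ⟨hL, by linarith⟩

/-- Losing on the metric already gives the inequality with gain `√Ec`; as `0 ≤ κ`, this implies the
one with `√Ec - κ`, so elimination and a failed test share one bound. -/
theorem confused_of_metric_le (hκ : 0 ≤ κ) (hL : d.1 ≤ T)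
    (hp : ∀ j < T, p j = splice w d.2 (T - d.1) j)
    (h : C.metric H f (C.received H Ec w f z) T w ≤ C.metric H f (C.received H Ec w f z) T p) :
    C.Confused H w T (√Ec - κ) f z d := by
  have h1 := metric_sub_metric f (C.received H Ec w f z) T p w
  rw [sum_symbol_sub hp] at h1
  have h2 : 0 ≤ κ * ∑ q ∈ C.support H T d.1 d.2, f q.1 q.2 ^ 2 :=
    mul_nonneg hκ (Finset.sum_nonneg fun q _ => sq_nonneg _)
  exact ⟨hL, by linarith⟩

end Difference

end ConvCode

theorem flagLabel_ite_eq_C_iff {q : Prop} [Decidable q] :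
    (if q then FlagLabel.C else FlagLabel.X) = FlagLabel.C ↔ q := by
  split_ifs <;> simp_all

namespace ConvCode

variable {C : ConvCode}

/-! ### The survivors of the Yamamoto-Itoh decoder -/

section Survivors

/-- The nodes of level `t` of the terminated trellis. -/
def ValidState (C : ConvCode) (H t : ℕ) (S : C.State) : Prop :=
  ∀ l : Fin C.m, (t ≤ (l : ℕ) ∨ H + l + 1 ≤ t) → S l = 0

theorem validState_state {H : ℕ} {w : C.Input} (hw : ∀ j, H ≤ j → w j = 0) (t : ℕ) :
    C.ValidState H t (C.state w t) := by
  intro l hl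
  simp only [state]
  split_ifs with h
  · exact hw _ (by omega)
  · rfl

variable {H : ℕ} {κ : ℝ} {pick : Finset C.Branch → C.Branch}
  {f y : Fin (H + C.m) → Fin C.nc → ℝ} {t : ℕ} {S : C.State} {e : C.Branch}

theorem mem_entering : e ∈ C.entering H t S ↔ C.Admissible H t e ∧ C.target e = S := by
  simp [entering]

theorem validState_source (he : C.Admissible H t e) : C.ValidState H t (C.source e) := by
  intro l hl
  refine he l.succ ?_
  rw [Fin.val_succ]
  omega

theorem entering_nonempty (hS : C.ValidState H (t + 1) S) : (C.entering H t S).Nonempty := by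
  -- A zero in the oldest register cell is admissible at every level.
  refine ⟨Fin.snoc (α := fun _ => C.Block) S 0, mem_entering.2 ⟨fun l => ?_, ?_⟩⟩
  · refine Fin.lastCases (fun _ => ?_) (fun k hk => ?_) l
    · simp
    · rw [Fin.snoc_castSucc]
      rw [Fin.val_castSucc] at hk
      exact hS k (by omega)
  · funext l
    simp [target]

theorem branch_mem_entering {w : C.Input} (hw : ∀ j, H ≤ j → w j = 0) (t : ℕ) :
    C.branch w t ∈ C.entering H t (C.state w (t + 1)) := by
  refine mem_entering.2 ⟨fun l hl => ?_, target_branch w t⟩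
  simp only [branch]
  split_ifs with h
  · exact hw _ (by omega)
  · rfl

variable (H κ pick f y) in
/-- The survivor at the node where the branch `e` starts, extended by `e`. -/
noncomputable def extension (t : ℕ) (e : C.Branch) : C.Input :=
  Function.update (C.survivor H κ pick f y t (C.source e)).1 t (e 0)

open Classical in
variable (H κ pick f y) in
/-- The last branch of the survivor at the node `S` of level `t + 1`. -/
noncomputable def bestBranch (t : ℕ) (S : C.State) : C.Branch :=
  pick ((C.entering H t S).filter fun e => ∀ e' ∈ C.entering H t S,
    C.metric H f y (t + 1) (extension H κ pick f y t e') ≤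
      C.metric H f y (t + 1) (extension H κ pick f y t e))

theorem survivor_succ_fst : (C.survivor H κ pick f y (t + 1) S).1 =
    extension H κ pick f y t (bestBranch H κ pick f y t S) := rfl

theorem survivor_succ_snd_eq_C_iff : (C.survivor H κ pick f y (t + 1) S).2 = FlagLabel.C ↔
    (C.survivor H κ pick f y t (C.source (bestBranch H κ pick f y t S))).2 = FlagLabel.C ∧
      ∀ e ∈ C.entering H t S, e ≠ bestBranch H κ pick f y t S →
        C.PassesTest H κ f y (t + 1) (extension H κ pick f y t (bestBranch H κ pick f y t S))
          (extension H κ pick f y t e) := by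
  classical
  exact @flagLabel_ite_eq_C_iff _ _

theorem extension_of_lt {j : ℕ} (hj : j < t) : extension H κ pick f y t e j =
    (C.survivor H κ pick f y t (C.source e)).1 j := by
  rw [extension, Function.update_of_ne hj.ne]

theorem extension_self : extension H κ pick f y t e t = e 0 := by
  rw [extension, Function.update_self]

theorem bestBranch_spec (hpick : ∀ B : Finset C.Branch, B.Nonempty → pick B ∈ B)
    (hS : C.ValidState H (t + 1) S) :
    bestBranch H κ pick f y t S ∈ C.entering H t S ∧ ∀ e ∈ C.entering H t S,
      C.metric H f y (t + 1) (extension H κ pick f y t e) ≤ C.metric H f y (t + 1)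
        (extension H κ pick f y t (bestBranch H κ pick f y t S)) := by
  classical
  obtain ⟨e, he, hmax⟩ := Finset.exists_max_image (C.entering H t S)
    (fun e => C.metric H f y (t + 1) (extension H κ pick f y t e)) (entering_nonempty hS)
  exact Finset.mem_filter.1 (hpick _ ⟨e, Finset.mem_filter.2 ⟨he, hmax⟩⟩)

theorem branch_extension (hst : C.state (C.survivor H κ pick f y t (C.source e)).1 t = C.source e) :
    C.branch (extension H κ pick f y t e) t = e := by
  refine eq_of_source_eq ?_ ?_
  · rw [branch_zero, extension_self]
  · rw [source_branch, ← hst]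
    exact state_congr fun k hk => extension_of_lt hk

theorem state_survivor (hpick : ∀ B : Finset C.Branch, B.Nonempty → pick B ∈ B)
    (hS : C.ValidState H t S) : C.state (C.survivor H κ pick f y t S).1 t = S := by
  induction t generalizing S with
  | zero =>
    funext l
    rw [hS l (Or.inl (Nat.zero_le _))]
    simp [state]
  | succ t ih =>
    have he := mem_entering.1 (bestBranch_spec (κ := κ) (f := f) (y := y) hpick hS).1
    rw [survivor_succ_fst, ← target_branch, branch_extension (ih (validState_source he.1)), he.2]

theorem branch_extension_of_admissible (hpick : ∀ B : Finset C.Branch, B.Nonempty → pick B ∈ B)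
    (he : C.Admissible H t e) : C.branch (extension H κ pick f y t e) t = e :=
  branch_extension (state_survivor hpick (validState_source he))

/-- The initial segments of a survivor are survivors. -/
theorem survivor_prefix (hpick : ∀ B : Finset C.Branch, B.Nonempty → pick B ∈ B)
    (hS : C.ValidState H t S) {t₀ : ℕ} (ht₀ : t₀ ≤ t) {j : ℕ} (hj : j < t₀) :
    (C.survivor H κ pick f y t S).1 j =
      (C.survivor H κ pick f y t₀ (C.state (C.survivor H κ pick f y t S).1 t₀)).1 j := by
  induction t generalizing S with
  | zero => omega
  | succ t ih =>
    rcases Nat.le_succ_iff.1 ht₀ with h | rfl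
    · have he := mem_entering.1 (bestBranch_spec (κ := κ) (f := f) (y := y) hpick hS).1
      rw [survivor_succ_fst, extension_of_lt (by omega), ih (validState_source he.1) h]
      exact congrArg (fun S => (C.survivor H κ pick f y t₀ S).1 j)
        (state_congr fun k hk => (extension_of_lt (by omega)).symm)
    · rw [state_survivor hpick hS]

theorem extension_prefix (hpick : ∀ B : Finset C.Branch, B.Nonempty → pick B ∈ B)
    (he : C.Admissible H t e) {t₀ : ℕ} (ht₀ : t₀ ≤ t) {j : ℕ} (hj : j < t₀) :
    extension H κ pick f y t e j =
      (C.survivor H κ pick f y t₀ (C.state (extension H κ pick f y t e) t₀)).1 j := by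
  rw [extension_of_lt (by omega), survivor_prefix hpick (validState_source he) ht₀ hj]
  exact congrArg (fun S => (C.survivor H κ pick f y t₀ S).1 j)
    (state_congr fun k hk => (extension_of_lt (by omega)).symm)

variable {w : C.Input}

theorem Survives.mono (hpick : ∀ B : Finset C.Branch, B.Nonempty → pick B ∈ B)
    (hw : ∀ j, H ≤ j → w j = 0) (h : C.Survives H κ pick f y w t) {t₀ : ℕ} (ht₀ : t₀ ≤ t) :
    C.Survives H κ pick f y w t₀ := by
  intro j hj
  rw [← h j (by omega), survivor_prefix hpick (validState_state hw t) ht₀ hj]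
  exact congrArg (fun S => (C.survivor H κ pick f y t₀ S).1 j)
    (state_congr fun k hk => (h k (by omega)).symm)

theorem Survives.extension_eq (h : C.Survives H κ pick f y w t) {j : ℕ} (hj : j < t + 1) :
    extension H κ pick f y t (C.branch w t) j = w j := by
  rcases Nat.lt_succ_iff_lt_or_eq.1 hj with h' | rfl
  · rw [extension_of_lt h', source_branch, h j h']
  · rw [extension_self, branch_zero]

/-- At a node shared with `w`, the initial segment of the extension is the survivor there, hence `w`
itself. This is the agreement that `ConvCode.exists_detour` requires. -/
theorem Survives.exists_detour (hpick : ∀ B : Finset C.Branch, B.Nonempty → pick B ∈ B)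
    (hw : ∀ j, H ≤ j → w j = 0) (h : C.Survives H κ pick f y w t)
    (he : e ∈ C.entering H t (C.state w (t + 1))) (hne : e ≠ C.branch w t) :
    ∃ d : ℕ × C.Input, C.IsDetour d.1 d.2 ∧ d.1 ≤ t + 1 ∧
      ∀ j < t + 1, extension H κ pick f y t e j = splice w d.2 (t + 1 - d.1) j := by
  obtain ⟨he, het⟩ := mem_entering.1 he
  have hbr := branch_extension_of_admissible (κ := κ) (f := f) (y := y) hpick he
  refine ConvCode.exists_detour ?_ ?_ ?_
  · rw [← target_branch, hbr, het]
  · by_contra! hall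
    exact hne (hbr.symm.trans (branch_congr fun k hk => hall k (by omega)))
  · intro t₀ ht₀ hst j hj
    rw [extension_prefix hpick he (by omega) hj, hst]
    exact h.mono hpick hw (by omega) j hj

/-- If the transmitted path survives up to level `t`, and is not a survivor with label `C` at the
next level although it had this label before, then it is confused with some detour. -/
theorem Survives.exists_confused {Ec : ℝ} {z : Fin (H + C.m) → Fin C.nc → ℝ}
    (hpick : ∀ B : Finset C.Branch, B.Nonempty → pick B ∈ B)
    (hw : ∀ j, H ≤ j → w j = 0) (hκ : 0 ≤ κ)
    (h : C.Survives H κ pick f (C.received H Ec w f z) w t)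
    (hC : (C.survivor H κ pick f (C.received H Ec w f z) t (C.state w t)).2 = FlagLabel.C)
    (hnot : ¬ (C.Survives H κ pick f (C.received H Ec w f z) w (t + 1) ∧
      (C.survivor H κ pick f (C.received H Ec w f z) (t + 1) (C.state w (t + 1))).2 =
        FlagLabel.C)) :
    ∃ d : ℕ × C.Input, C.IsDetour d.1 d.2 ∧ C.Confused H w (t + 1) (√Ec - κ) f z d := by
  set y := C.received H Ec w f z with hy
  have hS := validState_state hw (t + 1)
  obtain ⟨hb, hbmax⟩ := bestBranch_spec (κ := κ) (f := f) (y := y) hpick hS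
  -- Either `w` wins its node and loses the label by failing a test, or another path beats it on the
  -- metric.
  by_cases hbw : bestBranch H κ pick f y t (C.state w (t + 1)) = C.branch w t
  · have hsurv : C.Survives H κ pick f y w (t + 1) := fun j hj => by
      rw [survivor_succ_fst, hbw, h.extension_eq hj]
    have hlabel : ¬ (C.survivor H κ pick f y (t + 1) (C.state w (t + 1))).2 = FlagLabel.C :=
      fun hl => hnot ⟨hsurv, hl⟩
    rw [survivor_succ_snd_eq_C_iff, hbw, source_branch] at hlabel
    push Not at hlabel
    obtain ⟨e, he, hne, hfail⟩ := hlabel hC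
    obtain ⟨d, hd, hdt, hsp⟩ := h.exists_detour hpick hw he hne
    refine ⟨d, hd, confused_of_not_passesTest hdt hsp fun hp => hfail ?_⟩
    exact hp.congr (fun j hj => (h.extension_eq hj).symm) fun j hj => rfl
  · obtain ⟨d, hd, hdt, hsp⟩ := h.exists_detour hpick hw hb hbw
    refine ⟨d, hd, confused_of_metric_le hκ hdt hsp ?_⟩
    rw [← metric_congr f y (fun j hj => h.extension_eq hj)]
    exact hbmax _ (branch_mem_entering hw t)

theorem RetransmissionEvent.exists_confused {Ec : ℝ} {z : Fin (H + C.m) → Fin C.nc → ℝ}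
    (hpick : ∀ B : Finset C.Branch, B.Nonempty → pick B ∈ B)
    (hw : ∀ j, H ≤ j → w j = 0) (hκ : 0 ≤ κ)
    (h : C.RetransmissionEvent H κ pick f (C.received H Ec w f z) w t) :
    ∃ d : ℕ × C.Input, C.IsDetour d.1 d.2 ∧ C.Confused H w (t + 1) (√Ec - κ) f z d := by
  refine h.1.exists_confused hpick hw hκ h.2.1 fun hn => ?_
  rw [h.2.2] at hn
  exact FlagLabel.noConfusion hn.2

/-- A frame may be rejected after `w` has been eliminated by a path labelled `C`, so retransmission
events alone do not suffice. The induction keeps both survival and label, and its first failure of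
either kind yields a confusion. -/
theorem FrameRetransmission.exists_confused {Ec : ℝ} {z : Fin (H + C.m) → Fin C.nc → ℝ}
    (hpick : ∀ B : Finset C.Branch, B.Nonempty → pick B ∈ B)
    (hw : ∀ j, H ≤ j → w j = 0) (hκ : 0 ≤ κ)
    (h : C.FrameRetransmission H κ pick f (C.received H Ec w f z)) :
    ∃ t ∈ Finset.Ico C.m (H + C.m), ∃ d : ℕ × C.Input, C.IsDetour d.1 d.2 ∧
      C.Confused H w (t + 1) (√Ec - κ) f z d := by
  set y := C.received H Ec w f z with hy
  by_contra hcon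
  have hgood (t : ℕ) (ht : t ≤ H + C.m) : C.Survives H κ pick f y w t ∧
      (C.survivor H κ pick f y t (C.state w t)).2 = FlagLabel.C := by
    induction t with
    | zero => exact ⟨fun j hj => absurd hj (Nat.not_lt_zero j), rfl⟩
    | succ t ih =>
      obtain ⟨h1, h2⟩ := ih (by omega)
      by_contra hnot
      obtain ⟨d, hd, hconf⟩ := h1.exists_confused hpick hw hκ h2 hnot
      have hm := hd.memory_lt
      have hdt := hconf.1
      exact hcon ⟨t, Finset.mem_Ico.2 ⟨by omega, by omega⟩, d, hd, hconf⟩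
  -- The zero tail has flushed the register.
  have hend : C.state w (H + C.m) = 0 := by
    funext l
    have := l.2
    exact validState_state hw (H + C.m) l (by omega)
  have hlast := (hgood _ le_rfl).2
  rw [hend, h] at hlast
  exact FlagLabel.noConfusion hlast

/-- The winner carries the label `C`, so it passed the test against the extension of `w`; this gives
the gain `√Ec + κ`. -/
theorem FirstEventError.exists_confused {Ec : ℝ} {z : Fin (H + C.m) → Fin C.nc → ℝ}
    (hpick : ∀ B : Finset C.Branch, B.Nonempty → pick B ∈ B)
    (hw : ∀ j, H ≤ j → w j = 0)
    (h : C.FirstEventError H κ pick f (C.received H Ec w f z) w t) :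
    ∃ d : ℕ × C.Input, C.IsDetour d.1 d.2 ∧ C.Confused H w (t + 1) (√Ec + κ) f z d ∧
      C.bitErrors H κ pick f (C.received H Ec w f z) w t = C.infoWeight d.1 d.2 := by
  set y := C.received H Ec w f z with hy
  obtain ⟨h1, h2, h3⟩ := id h
  obtain ⟨hb, -⟩ := bestBranch_spec (κ := κ) (f := f) (y := y) hpick (validState_state hw (t + 1))
  have hbw : bestBranch H κ pick f y t (C.state w (t + 1)) ≠ C.branch w t := fun hbw =>
    h2 fun j hj => by rw [survivor_succ_fst, hbw, h1.extension_eq hj]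
  obtain ⟨d, hd, hdt, hsp⟩ := h1.exists_detour hpick hw hb hbw
  rw [survivor_succ_snd_eq_C_iff] at h3
  refine ⟨d, hd, confused_of_passesTest hdt hsp ((h3.2 _ (branch_mem_entering hw t)
    (Ne.symm hbw)).congr (fun _ _ => rfl) fun j hj => h1.extension_eq hj), ?_⟩
  rw [bitErrors, if_pos h, ← infoWeight_eq_card_ne hdt hsp]
  rfl

end Survivors


/-! ### Union bounds over the detours -/

section UnionBound

theorem a_eq_card (hT : C.HasTransferFunction) (k : ℕ) : C.a k = (hT k).toFinset.card := by
  rw [a, transferFunction, PowerSeries.coeff_mk, finsum_mem_eq_finite_toFinset_sum _ (hT k),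
    Polynomial.eval_finsetSum]
  simp

theorem c_eq_sum (hT : C.HasTransferFunction) (k : ℕ) :
    C.c k = ∑ d ∈ (hT k).toFinset, C.infoWeight d.1 d.2 := by
  rw [c, transferFunction, PowerSeries.coeff_mk, finsum_mem_eq_finite_toFinset_sum _ (hT k),
    Polynomial.derivative_sum, Polynomial.eval_finsetSum]
  refine Finset.sum_congr rfl fun d _ => ?_
  simp [Polynomial.derivative_X_pow]

theorem weight_mem_Icc {H T : ℕ} {d : ℕ × C.Input} (hd : C.IsDetour d.1 d.2) (hdT : d.1 ≤ T)
    (hT : T ≤ H + C.m) : C.weight d.1 d.2 ∈ Finset.Icc C.freeDist (C.nc * (H + C.m)) := by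
  refine Finset.mem_Icc.2 ⟨Nat.sInf_le ⟨d, hd, rfl⟩, ?_⟩
  rw [← card_support hdT hT]
  refine (Finset.card_le_univ _).trans_eq ?_
  rw [Fintype.card_prod, Fintype.card_fin, Fintype.card_fin, mul_comm]

variable {Ω : Type*} [MeasurableSpace Ω] {P : Measure Ω} {Ev : ℕ × C.Input → Set Ω} {D : ℝ} {N : ℕ}

/-- Monotonicity and subadditivity hold for outer measure, so measurability of the decoder events is
not needed. -/
theorem measureReal_le_sum_a (hT : C.HasTransferFunction) (hD : 0 ≤ D)
    (hEv : ∀ d, P (Ev d) ≤ ENNReal.ofReal (D ^ C.weight d.1 d.2)) {E : Set Ω}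
    (hE : ∀ ω ∈ E, ∃ d : ℕ × C.Input, C.IsDetour d.1 d.2 ∧
      C.weight d.1 d.2 ∈ Finset.Icc C.freeDist N ∧ ω ∈ Ev d) :
    P.real E ≤ ∑ k ∈ Finset.Icc C.freeDist N, (C.a k : ℝ) * D ^ k := by
  refine ENNReal.toReal_le_of_le_ofReal (Finset.sum_nonneg fun k _ => by positivity) ?_
  have hsub : E ⊆ ⋃ k ∈ Finset.Icc C.freeDist N, ⋃ d ∈ (hT k).toFinset, Ev d := by
    intro ω hω
    obtain ⟨d, hd, hk, hωd⟩ := hE ω hω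
    simp only [Set.mem_iUnion]
    exact ⟨_, hk, d, (hT _).mem_toFinset.2 ⟨hd, rfl⟩, hωd⟩
  rw [ENNReal.ofReal_sum_of_nonneg fun k _ => by positivity]
  refine (measure_mono hsub).trans ((measure_biUnion_finset_le _ _).trans
    (Finset.sum_le_sum fun k _ => (measure_biUnion_finset_le _ _).trans ?_))
  refine (Finset.sum_le_card_nsmul _ _ (ENNReal.ofReal (D ^ k)) fun d hd => ?_).trans_eq ?_
  · have h := ((hT k).mem_toFinset.1 hd).2
    rw [← h]
    exact hEv d
  · rw [nsmul_eq_mul, ← a_eq_card hT, ENNReal.ofReal_mul (Nat.cast_nonneg _),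
      ENNReal.ofReal_natCast]

theorem toReal_lintegral_le_sum_c (hT : C.HasTransferFunction) (hD : 0 ≤ D)
    (hEv : ∀ d, P (Ev d) ≤ ENNReal.ofReal (D ^ C.weight d.1 d.2)) {F : Ω → ℕ}
    (hF : ∀ ω, F ω ≠ 0 → ∃ d : ℕ × C.Input, C.IsDetour d.1 d.2 ∧
      C.weight d.1 d.2 ∈ Finset.Icc C.freeDist N ∧ ω ∈ Ev d ∧ F ω = C.infoWeight d.1 d.2) :
    (∫⁻ ω, (F ω : ENNReal) ∂P).toReal ≤
      ∑ k ∈ Finset.Icc C.freeDist N, (C.c k : ℝ) * D ^ k := by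
  refine ENNReal.toReal_le_of_le_ofReal (Finset.sum_nonneg fun k _ => by positivity) ?_
  -- Measurable hulls have the same measure as the events and make the sum of integrals additive.
  set G : ℕ × C.Input → Ω → ENNReal := fun d =>
    (toMeasurable P (Ev d)).indicator fun _ => (C.infoWeight d.1 d.2 : ENNReal) with hG
  have hGm (d : ℕ × C.Input) : Measurable (G d) :=
    measurable_const.indicator (measurableSet_toMeasurable _ _)
  have hle (ω : Ω) : (F ω : ENNReal) ≤
      ∑ k ∈ Finset.Icc C.freeDist N, ∑ d ∈ (hT k).toFinset, G d ω := by
    by_cases h0 : F ω = 0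
    · simp [h0]
    obtain ⟨d, hd, hk, hωd, hFd⟩ := hF ω h0
    have hGd : G d ω = F ω := by
      simp only [hG]
      rw [Set.indicator_of_mem (subset_toMeasurable _ _ hωd), hFd]
    rw [← hGd]
    exact (Finset.single_le_sum (f := fun d => G d ω) (fun _ _ => zero_le)
      ((hT _).mem_toFinset.2 ⟨hd, rfl⟩)).trans
      (Finset.single_le_sum (f := fun k => ∑ d ∈ (hT k).toFinset, G d ω)
        (fun _ _ => zero_le) hk)
  rw [ENNReal.ofReal_sum_of_nonneg fun k _ => by positivity]
  refine (lintegral_mono hle).trans ?_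
  rw [lintegral_finsetSum _ fun k _ => Finset.measurable_sum _ fun d _ => hGm d]
  refine Finset.sum_le_sum fun k _ => ?_
  rw [lintegral_finsetSum _ fun d _ => hGm d, ENNReal.ofReal_mul (Nat.cast_nonneg _),
    ENNReal.ofReal_natCast, c_eq_sum hT, Nat.cast_sum, Finset.sum_mul]
  refine Finset.sum_le_sum fun d hd => ?_
  have h := ((hT k).mem_toFinset.1 hd).2
  simp only [hG]
  rw [lintegral_indicator_const (measurableSet_toMeasurable _ _), measure_toMeasurable, ← h]
  gcongr
  exact hEv d

end UnionBound

/-! ### Probability of confusion with one detour -/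

section Fading

variable {Ω : Type*} [MeasurableSpace Ω] {P : Measure Ω} [IsProbabilityMeasure P] {H : ℕ}
  {N₀ σ s ρ v c : ℝ} {α n : Fin (H + C.m) → Fin C.nc → Ω → ℝ}

theorem measure_confused_le (hN₀ : 0 < N₀) (hσ : 0 < σ) (hc : 0 ≤ c)
    (hcv : c ^ 2 / N₀ = 1 / 2 * (√(2 * ρ) + v) ^ 2)
    (hα : ∀ j i, HasLaw (α j i) (ricianLaw s σ) P)
    (hn : ∀ j i, HasLaw (n j i) (gaussianReal 0 (N₀ / 2).toNNReal) P)
    (hindep : iIndepFun (Sum.elim (fun q : Fin (H + C.m) × Fin C.nc => α q.1 q.2)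
      (fun q : Fin (H + C.m) × Fin C.nc => n q.1 q.2)) P)
    (w : C.Input) {T : ℕ} (hT : T ≤ H + C.m) (d : ℕ × C.Input) :
    P {ω | C.Confused H w T c (fun j i => α j i ω) (fun j i => n j i ω) d} ≤
      ENNReal.ofReal (Dtilde ρ v σ s ^ C.weight d.1 d.2) := by
  by_cases hd : d.1 ≤ T
  · rw [← card_support hd hT]
    refine (measure_mono fun ω hω => hω.2).trans
      (measure_rician_gaussian_le (α := fun q : Fin (H + C.m) × Fin C.nc => α q.1 q.2)
        (n := fun q : Fin (H + C.m) × Fin C.nc => n q.1 q.2) hN₀ hσ hc hcv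
        (fun q => hα q.1 q.2) (fun q => hn q.1 q.2) hindep (C.support H T d.1 d.2)
        (ε := fun q => -C.symbol w q.1 q.2) fun q => ?_)
    rw [neg_sq, symbol_sq]
  · have h : {ω | C.Confused H w T c (fun j i => α j i ω) (fun j i => n j i ω) d} = ∅ :=
      Set.eq_empty_of_forall_notMem fun ω hω => hd hω.1
    rw [h, measure_empty]
    exact zero_le

end Fading

theorem sqrt_two_mul_div_mul_sqrt {Ec N₀ : ℝ} (hN₀ : 0 < N₀) :
    √(2 * (Ec / N₀)) * √(N₀ / 2) = √Ec := by
  rw [← Real.sqrt_mul' _ (by positivity)]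
  congr 1
  field_simp

/-- Both amplitude and threshold are multiples of the noise deviation `√(N₀ / 2)`; factoring it out
gives the normalised form in `coefA`. -/
theorem sqrt_add_sq_div {Ec N₀ : ℝ} (hN₀ : 0 < N₀) (v : ℝ) :
    (√Ec + v * √(N₀ / 2)) ^ 2 / N₀ = 1 / 2 * (√(2 * (Ec / N₀)) + v) ^ 2 := by
  rw [← sqrt_two_mul_div_mul_sqrt hN₀, ← add_mul, mul_pow, Real.sq_sqrt (by positivity)]
  field_simp

end ConvCode

/-! ### The performance bounds -/

theorem proposition1 {Ω : Type*} [MeasurableSpace Ω] (P : Measure Ω) [IsProbabilityMeasure P]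
    (C : ConvCode) (hT : C.HasTransferFunction) (hdf : 0 < C.freeDist)
    (H : ℕ) (hH : 0 < H)
    (Ec N₀ σ s u : ℝ) (hEc : 0 < Ec) (hN₀ : 0 < N₀) (hσ : 0 < σ) (hs : 0 ≤ s) (hu : 0 ≤ u)
    (pick : Finset C.Branch → C.Branch) (hpick : ∀ B : Finset C.Branch, B.Nonempty → pick B ∈ B)
    (α n : Fin (H + C.m) → Fin C.nc → Ω → ℝ)
    (hα : ∀ j i, HasLaw (α j i) (ricianLaw s σ) P)
    (hn : ∀ j i, HasLaw (n j i) (gaussianReal 0 (N₀ / 2).toNNReal) P)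
    (hindep : iIndepFun (Sum.elim (fun q : Fin (H + C.m) × Fin C.nc => α q.1 q.2)
      (fun q : Fin (H + C.m) × Fin C.nc => n q.1 q.2)) P)
    (w : C.Input) (hw : ∀ j, H ≤ j → w j = 0) :
    (∀ t < H + C.m,
      C.Pe H Ec N₀ u pick P α n w t ≤
        ∑ k ∈ Finset.Icc C.freeDist (C.nc * (H + C.m)),
          (C.a k : ℝ) * Dtilde (Ec / N₀) (u / C.freeDist) σ s ^ k) ∧
    (u < C.freeDist * √(2 * Ec / N₀) →
      (∀ t < H + C.m,
        C.Px H Ec N₀ u pick P α n w t ≤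
          ∑ k ∈ Finset.Icc C.freeDist (C.nc * (H + C.m)),
            (C.a k : ℝ) * Dtilde (Ec / N₀) (-u / C.freeDist) σ s ^ k) ∧
      C.PxFrame H Ec N₀ u pick P α n w ≤
        H * ∑ k ∈ Finset.Icc C.freeDist (C.nc * (H + C.m)),
          (C.a k : ℝ) * Dtilde (Ec / N₀) (-u / C.freeDist) σ s ^ k) ∧
    (∀ t < H + C.m,
      C.Pb H Ec N₀ u pick P α n w t ≤
        ∑ k ∈ Finset.Icc C.freeDist (C.nc * (H + C.m)),
          (C.c k : ℝ) * Dtilde (Ec / N₀) (u / C.freeDist) σ s ^ k) := by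
  have hd0 : (0 : ℝ) < C.freeDist := Nat.cast_pos.2 hdf
  have hκ : 0 ≤ C.threshold N₀ u := by unfold ConvCode.threshold; positivity
  have herr (t : ℕ) (ht : t < H + C.m) (d : ℕ × C.Input) := ConvCode.measure_confused_le hN₀ hσ
    (c := √Ec + C.threshold N₀ u) (by positivity) (ConvCode.sqrt_add_sq_div hN₀ (u / C.freeDist))
    hα hn hindep w (Nat.succ_le_of_lt ht) d
  refine ⟨fun t ht => ?_, fun hlt => ?_, fun t ht => ?_⟩
  · refine ConvCode.measureReal_le_sum_a hT (Dtilde_nonneg hσ) (herr t ht) fun ω hω => ?_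
    obtain ⟨d, hd, hconf, -⟩ := ConvCode.FirstEventError.exists_confused hpick hw hω
    exact ⟨d, hd, ConvCode.weight_mem_Icc hd hconf.1 (Nat.succ_le_of_lt ht), hconf⟩
  -- The restriction on `u` makes the gain, and with it the Chernoff parameter, nonnegative.
  · have hc0 : 0 ≤ √Ec - C.threshold N₀ u := by
      rw [sub_nonneg, ← ConvCode.sqrt_two_mul_div_mul_sqrt hN₀, ← mul_div_assoc,
        ConvCode.threshold]
      refine mul_le_mul_of_nonneg_right ?_ (Real.sqrt_nonneg _)
      rw [div_le_iff₀' hd0]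
      exact hlt.le
    have hcv : (√Ec - C.threshold N₀ u) ^ 2 / N₀ =
        1 / 2 * (√(2 * (Ec / N₀)) + -u / C.freeDist) ^ 2 := by
      rw [← ConvCode.sqrt_add_sq_div hN₀, ConvCode.threshold]
      ring
    have hret (t : ℕ) (ht : t < H + C.m) (d : ℕ × C.Input) := ConvCode.measure_confused_le hN₀ hσ
      hc0 hcv hα hn hindep w (Nat.succ_le_of_lt ht) d
    have hbound (t : ℕ) (ht : t < H + C.m) {E : Set Ω} (hE : ∀ ω ∈ E, ∃ d : ℕ × C.Input,
        C.IsDetour d.1 d.2 ∧ C.Confused H w (t + 1) (√Ec - C.threshold N₀ u)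
          (fun j i => α j i ω) (fun j i => n j i ω) d) :
        P.real E ≤ ∑ k ∈ Finset.Icc C.freeDist (C.nc * (H + C.m)),
          (C.a k : ℝ) * Dtilde (Ec / N₀) (-u / C.freeDist) σ s ^ k := by
      refine ConvCode.measureReal_le_sum_a hT (Dtilde_nonneg hσ) (hret t ht) fun ω hω => ?_
      obtain ⟨d, hd, hconf⟩ := hE ω hω
      exact ⟨d, hd, ConvCode.weight_mem_Icc hd hconf.1 (Nat.succ_le_of_lt ht), hconf⟩
    refine ⟨fun t ht => hbound t ht fun ω hω =>
      ConvCode.RetransmissionEvent.exists_confused hpick hw hκ hω, ?_⟩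
    -- The union runs over the `H` levels from `C.m` on, each with the same bound.
    calc C.PxFrame H Ec N₀ u pick P α n w
        ≤ P.real (⋃ t ∈ Finset.Ico C.m (H + C.m), {ω | ∃ d : ℕ × C.Input,
            C.IsDetour d.1 d.2 ∧ C.Confused H w (t + 1) (√Ec - C.threshold N₀ u)
              (fun j i => α j i ω) (fun j i => n j i ω) d}) := by
          refine measureReal_mono (fun ω hω => ?_) (measure_ne_top _ _)
          obtain ⟨t, ht, h⟩ := ConvCode.FrameRetransmission.exists_confused hpick hw hκ hω
          exact Set.mem_biUnion ht h
      _ ≤ _ := measureReal_biUnion_finset_le _ _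
      _ ≤ _ := Finset.sum_le_card_nsmul _ _ _ fun t ht =>
          hbound t (Finset.mem_Ico.1 ht).2 fun ω hω => hω
      _ = _ := by rw [Nat.card_Ico, Nat.add_sub_cancel, nsmul_eq_mul]
  · refine ConvCode.toReal_lintegral_le_sum_c hT (Dtilde_nonneg hσ) (herr t ht) fun ω hω => ?_
    have hev : C.FirstEventError H (C.threshold N₀ u) pick (fun j i => α j i ω)
        (C.received H Ec w (fun j i => α j i ω) (fun j i => n j i ω)) w t := by
      by_contra h
      exact hω (if_neg h)
    obtain ⟨d, hd, hconf, hbit⟩ := ConvCode.FirstEventError.exists_confused hpick hw hev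
    exact ⟨d, hd, ConvCode.weight_mem_Icc hd hconf.1 (Nat.succ_le_of_lt ht), hconf, hbit⟩
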